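/- For a permutation $w\in S_n$ of $\{1,\dots,n\}$, let $N_i(w)$ be the number of $i$-cycles of $w$ (fixed points being the $1$-cycles), let $v(w)$ be the number of valleys of $w$, that is, of indices $i$ with $1<i<n$ and $w(i-1)>w(i)<w(i+1)$, and let $p(w)$ be the number of peaks of $w$, that is, of indices $i$ with $1<i<n$ and $w(i-1)<w(i)>w(i+1)$. For integers $i,m\ge 1$ let $$f_{i,m}=\frac1{2i}\sum_{\substack{d\mid i\\ d\text{ odd}}}\mu(d)(2m)^{i/d},$$ where $\mu$ is the Möbius function; $f_{i,m}$ is a nonnegative integer. Let $K$ be a field of characteristic zero (for example $K=\mathbb Q$). Then, as an identity of formal power series over $K$ in the variables $t,u,x_1,x_2,\dots$, $$\frac{t}{1-t}+\sum_{n\ge1}u^n\sum_{w\in S_n}\frac12\,\frac{(1+t)^{n+1}}{(1-t)^{n+1}}\left(\frac{4t}{(1+t)^2}\right)^{v(w)+1}\prod_{i\ge1}x_i^{N_i(w)}=\sum_{m\ge1}t^m\prod_{i\ge1}\left(\frac{1+x_iu^i}{1-x_iu^i}\right)^{f_{i,m}},$$ where the infinite sums and products converge in the topology of coefficientwise eventual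 constancy. The same identity, with the same convergence, holds with $v(w)$ replaced by $p(w)$. -/

import Mathlib

open scoped MvPowerSeries.WithPiTopology

/-- `∑ μ(d) (2m)^(i/d)` over the odd divisors `d` of `i`, where `μ` is the Möbius function. -/
def cycleSum (i m : ℕ) : ℤ :=
  ∑ d ∈ i.divisors with Odd d, ArithmeticFunction.moebius d * (2 * (m : ℤ)) ^ (i / d)

theorem two_pow_dvd_cycleSum {k i : ℕ} (m : ℕ) (hk : 2 ^ k ∣ 2 * i) (hi : i ≠ 0) :
    (2 : ℤ) ^ k ∣ cycleSum i m := by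
  refine Finset.dvd_sum fun d hd => Dvd.dvd.mul_left ?_ _
  simp only [Finset.mem_filter, Nat.mem_divisors] at hd
  obtain ⟨⟨⟨e, rfl⟩, -⟩, hodd⟩ := hd
  have hd0 : 0 < d := hodd.pos
  rw [Nat.mul_div_cancel_left _ hd0]
  have he0 : e ≠ 0 := fun h => hi (by simp [h])
  have hke : k ≤ e := by
    rcases k with _ | k
    · omega
    have h1 : 2 ^ k ∣ d * e := by
      rw [pow_succ'] at hk
      exact Nat.dvd_of_mul_dvd_mul_left two_pos hk
    have h2 : 2 ^ k ∣ e :=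
      Nat.Coprime.dvd_of_dvd_mul_left ((Nat.coprime_two_left.mpr hodd).pow_left k) h1
    have h3 := Nat.le_of_dvd (Nat.pos_of_ne_zero he0) h2
    have h4 : k < 2 ^ k := Nat.lt_two_pow_self
    omega
  rw [mul_pow]
  exact Dvd.dvd.mul_right (pow_dvd_pow 2 hke) _

theorem pow_dvd_cycleSum {p : ℕ} (hp : p.Prime) (hp2 : Odd p) (k c m : ℕ) (hc : c ≠ 0)
    (hpc : ¬ p ∣ c) : (p : ℤ) ^ (k + 1) ∣ cycleSum (p ^ (k + 1) * c) m := by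
  have hcop : Nat.Coprime (p ^ (k + 1)) c := ((Nat.Prime.coprime_iff_not_dvd hp).2 hpc).pow_left _
  unfold cycleSum
  rw [Finset.sum_filter, Nat.divisors_mul, Finset.mul_def,
    Finset.sum_image hcop.mul_injOn_divisors, Finset.sum_product_right]
  refine Finset.dvd_sum fun e he => ?_
  obtain ⟨he1, -⟩ := Nat.mem_divisors.1 he
  have hpe : Nat.Coprime p e := (Nat.Prime.coprime_iff_not_dvd hp).2 fun h => hpc (h.trans he1)
  obtain ⟨g, rfl⟩ := he1
  have he0 : 0 < e := Nat.pos_of_ne_zero fun h => hc (by simp [h])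
  simp only
  rw [Nat.sum_divisors_prime_pow hp, Finset.sum_range_succ', Finset.sum_range_succ',
    Finset.sum_eq_zero, zero_add, zero_add, pow_one, pow_zero, one_mul]
  · by_cases hoe : Odd e
    · rw [if_pos (hp2.mul hoe), if_pos hoe,
        ArithmeticFunction.isMultiplicative_moebius.map_mul_of_coprime hpe,
        ArithmeticFunction.moebius_apply_prime hp]
      have h1 : p ^ (k + 1) * (e * g) / (p * e) = g * p ^ k := by
        rw [show p ^ (k + 1) * (e * g) = (p * e) * (g * p ^ k) by ring]
        exact Nat.mul_div_cancel_left _ (Nat.mul_pos hp.pos he0)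
      have h2 : p ^ (k + 1) * (e * g) / e = g * p * p ^ k := by
        rw [show p ^ (k + 1) * (e * g) = e * (g * p * p ^ k) by ring]
        exact Nat.mul_div_cancel_left _ he0
      rw [h1, h2, pow_mul, pow_mul (2 * (m : ℤ)) (g * p)]
      have h3 : (p : ℤ) ∣ (2 * (m : ℤ)) ^ (g * p) - (2 * (m : ℤ)) ^ g := by
        have := Fact.mk hp
        rw [← ZMod.intCast_zmod_eq_zero_iff_dvd]
        push_cast
        rw [pow_mul, ZMod.pow_card, sub_self]
      have h4 := dvd_sub_pow_of_dvd_sub h3 k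
      convert h4.mul_left (ArithmeticFunction.moebius e) using 1
      ring
    · rw [if_neg hoe, if_neg fun h => hoe (Nat.odd_mul.1 h).2, add_zero]
      exact dvd_zero _
  · intro j _
    have : ArithmeticFunction.moebius (p ^ (j + 1 + 1) * e) = 0 := by
      refine ArithmeticFunction.moebius_eq_zero_of_not_squarefree fun h => ?_
      have := h p ⟨p ^ j * e, by ring⟩
      exact hp.one_lt.ne' (Nat.isUnit_iff.1 this)
    simp [this]

theorem two_mul_dvd_cycleSum {i : ℕ} (m : ℕ) (hi : i ≠ 0) : ((2 * i : ℕ) : ℤ) ∣ cycleSum i m := by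
  rw [Int.natCast_dvd, Nat.dvd_iff_prime_pow_dvd_dvd]
  intro p k hp hk
  rw [← Int.natCast_dvd]
  push_cast
  rcases hp.eq_two_or_odd' with rfl | hodd
  · exact two_pow_dvd_cycleSum m hk hi
  · have hk' : p ^ k ∣ i := Nat.Coprime.dvd_of_dvd_mul_left
      (Nat.Coprime.pow_left k (Nat.coprime_two_right.mpr hodd)) hk
    obtain ⟨n, c, hpc, rfl⟩ := Nat.exists_eq_pow_mul_and_not_dvd hi p hp.ne_one
    have hc : c ≠ 0 := fun h => hpc (by simp [h])
    have hkn : k ≤ n := by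
      have := (Nat.Prime.coprime_iff_not_dvd hp).2 hpc
      exact (Nat.pow_dvd_pow_iff_le_right hp.one_lt).1
        (Nat.Coprime.dvd_of_dvd_mul_right (this.pow_left k) hk')
    rcases n with _ | n
    · simp [Nat.le_zero.1 hkn]
    · exact (pow_dvd_pow _ hkn).trans (pow_dvd_cycleSum hp hodd n c m hc hpc)

theorem cycleSum_nonneg {i : ℕ} (m : ℕ) (hi : i ≠ 0) : 0 ≤ cycleSum i m := by
  rcases Nat.eq_zero_or_pos m with rfl | hm
  · refine Finset.sum_nonneg fun d hd => ?_
    simp only [Finset.mem_filter, Nat.mem_divisors] at hd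
    have : i / d ≠ 0 := (Nat.div_pos (Nat.le_of_dvd (Nat.pos_of_ne_zero hi) hd.1.1) hd.2.pos).ne'
    simp [this]
  have h1 : 1 ∈ i.divisors.filter (fun d => Odd d) := by simp [hi]
  unfold cycleSum
  rw [← Finset.add_sum_erase _ _ h1]
  set T := (i.divisors.filter (fun d => Odd d)).erase 1 with hT
  have hTm : ∀ d ∈ T, d ≠ 1 ∧ d ∣ i ∧ 0 < d := by
    intro d hd
    simp only [hT, Finset.mem_erase, Finset.mem_filter, Nat.mem_divisors] at hd
    exact ⟨hd.1, hd.2.1.1, hd.2.2.pos⟩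
  have h2 : ∑ k ∈ T.image (fun d => i / d), (2 * m) ^ k < (2 * m) ^ i := by
    refine Nat.geomSum_lt (by omega) ?_
    intro k hk
    obtain ⟨d, hd, rfl⟩ := Finset.mem_image.1 hk
    have := hTm d hd
    exact Nat.div_lt_self (Nat.pos_of_ne_zero hi) (by omega)
  rw [Finset.sum_image] at h2
  · have h3 : -∑ d ∈ T, (2 * (m : ℤ)) ^ (i / d) ≤
        ∑ d ∈ T, ArithmeticFunction.moebius d * (2 * (m : ℤ)) ^ (i / d) := by
      rw [← Finset.sum_neg_distrib]
      refine Finset.sum_le_sum fun d _ => ?_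
      have h5 : -1 ≤ ArithmeticFunction.moebius d :=
        (abs_le.1 (ArithmeticFunction.abs_moebius_le_one)).1
      have h6 : (0 : ℤ) ≤ (2 * (m : ℤ)) ^ (i / d) := by positivity
      nlinarith
    have h4 : ∑ d ∈ T, (2 * (m : ℤ)) ^ (i / d) < (2 * (m : ℤ)) ^ i := by exact_mod_cast h2
    simp only [ArithmeticFunction.moebius_apply_one, Nat.div_one, one_mul]
    linarith
  · intro a ha b hb hab
    have ha' := hTm a ha
    have hb' := hTm b hb
    simp only at hab
    rw [← Nat.div_div_self ha'.2.1 hi, ← Nat.div_div_self hb'.2.1 hi, hab]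

/-- The exponent `f_{i,m} = (1/(2i)) ∑ μ(d) (2m)^(i/d)` (sum over the odd divisors `d` of `i`).
It is a nonnegative integer for `i ≥ 1`; see `cast_cycleExponent`. -/
def cycleExponent (i m : ℕ) : ℕ :=
  (cycleSum i m / (2 * (i : ℤ))).toNat

/-- For `i ≥ 1` the division and the truncation in `cycleExponent` are exact. -/
theorem cast_cycleExponent {i : ℕ} (hi : i ≠ 0) (m : ℕ) :
    (cycleExponent i m : ℚ) = 1 / (2 * (i : ℚ)) *
      ∑ d ∈ i.divisors with Odd d,
        (ArithmeticFunction.moebius d : ℚ) * (2 * (m : ℚ)) ^ (i / d) := by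
  have h1 : 2 * (i : ℤ) ∣ cycleSum i m := by exact_mod_cast two_mul_dvd_cycleSum m hi
  have h2 : ((cycleExponent i m : ℤ) : ℤ) = cycleSum i m / (2 * (i : ℤ)) :=
    Int.toNat_of_nonneg (Int.ediv_nonneg (cycleSum_nonneg m hi) (by positivity))
  have h3 : (2 * (i : ℤ)) * (cycleExponent i m : ℤ) = cycleSum i m := by
    rw [h2, Int.mul_ediv_cancel' h1]
  have h4 : (2 * (i : ℚ)) * (cycleExponent i m : ℚ) = (cycleSum i m : ℚ) := by exact_mod_cast h3
  have h5 : (2 * (i : ℚ)) ≠ 0 := by positivity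
  rw [one_div, eq_inv_mul_iff_mul_eq₀ h5, h4]
  simp [cycleSum]

/-- The number of valleys of `w`: positions `i` that have a left neighbour `a` and a right
neighbour `b` with `w a > w i < w b`. -/
def valleyCount {n : ℕ} (w : Equiv.Perm (Fin n)) : ℕ :=
  (Finset.univ.filter fun i : Fin n =>
    ∃ a b : Fin n, (a : ℕ) + 1 = i ∧ (i : ℕ) + 1 = b ∧ w i < w a ∧ w i < w b).card

/-- The number of peaks of `w`: positions `i` that have a left neighbour `a` and a right
neighbour `b` with `w a < w i > w b`. -/
def peakCount {n : ℕ} (w : Equiv.Perm (Fin n)) : ℕ :=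
  (Finset.univ.filter fun i : Fin n =>
    ∃ a b : Fin n, (a : ℕ) + 1 = i ∧ (i : ℕ) + 1 = b ∧ w a < w i ∧ w b < w i).card

/-- The number `N_i(w)` of `i`-cycles of `w`; fixed points are the `1`-cycles. -/
def cycleCount {n : ℕ} (i : ℕ) (w : Equiv.Perm (Fin n)) : ℕ :=
  w.partition.parts.count i

/-- The variables `t`, `u`, `x_1`, `x_2`, `x_3`, … -/
inductive GenVar : Type
  | t : GenVar
  | u : GenVar
  | x (i : ℕ+) : GenVar

noncomputable section

/-- The variable `t` as a formal power series. -/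
def tVar (K : Type*) [Field K] : MvPowerSeries GenVar K := MvPowerSeries.X GenVar.t

/-- The variable `u` as a formal power series. -/
def uVar (K : Type*) [Field K] : MvPowerSeries GenVar K := MvPowerSeries.X GenVar.u

/-- The variable `x_i` as a formal power series. -/
def xVar (K : Type*) [Field K] (i : ℕ+) : MvPowerSeries GenVar K := MvPowerSeries.X (GenVar.x i)

/-- The term of degree `n` in `u` of the generating function of a permutation statistic `s`:
`u^n ∑_w (1/2) (1+t)^(n+1)/(1-t)^(n+1) (4t/(1+t)^2)^(s(w)+1) ∏_i x_i^(N_i(w))`,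
where `w` runs over the permutations of `n` symbols.  The power series `1 - t` and `(1 + t)^2`
have constant term `1`, so that `⁻¹` is the inverse.  The product has finitely many factors
different from `1`. -/
def permTerm (K : Type*) [Field K] (s : ∀ n : ℕ, Equiv.Perm (Fin n) → ℕ) (n : ℕ) :
    MvPowerSeries GenVar K :=
  uVar K ^ n * ∑ w : Equiv.Perm (Fin n),
    MvPowerSeries.C (1 / 2 : K) * ((1 + tVar K) ^ (n + 1) * ((1 - tVar K) ^ (n + 1))⁻¹) *
      (4 * tVar K * ((1 + tVar K) ^ 2)⁻¹) ^ (s n w + 1) *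
      ∏ᶠ i : ℕ+, xVar K i ^ cycleCount i w

/-- The factor `((1 + x_i u^i)/(1 - x_i u^i))^(f_{i,m})`. -/
def cycleFactor (K : Type*) [Field K] (m i : ℕ+) : MvPowerSeries GenVar K :=
  ((1 + xVar K i * uVar K ^ (i : ℕ)) * (1 - xVar K i * uVar K ^ (i : ℕ))⁻¹) ^ cycleExponent i m

end

/-! Fix `m` and use the alphabet `{0, …, 2m - 1}`, whose letters alternate in sign, starting with a
negative one. The pairs of a permutation `w` and a compatible word are counted in two ways.

Counted by `w`: as the alphabet grows, the numbers of compatible words obey a linear recursion along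
the ascents and descents of `w`. Its solution depends only on the length and the number of peaks,
and the generating function in `m` is exactly the prefactor in the theorem (`evenSeries_formula`).
Hence the coefficient of `t^m` on the permutation side counts compatible pairs by cycle type. The
empty permutation contributes `t/(1-t)`.

Counted by words: this is a signed version of the Gessel–Reutenauer bijection. Reading the letters
along the orbit of each position gives a shift-invariant multiset of periodic words, that is, a
multiset of necklaces. Order the words lexicographically, with every negative letter reversing later
comparisons. Compatibility says that the positions are sorted in this order, so the pair can be
recovered from the multiset, and every multiset occurs (`CompatiblePair.eq_of_map_itinerary_eq`,
`exists_compatiblePair`).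

The multiset also determines the cycle type. One turn around a positive necklace of period `p`
preserves the order of its copies, hence fixes them, and each copy is a `p`-cycle. One turn around a
negative necklace reverses that order, so the copies pair up into `2p`-cycles, except for one middle
`p`-cycle when their number is odd (`CompatiblePair.card_fiber_minimalPeriod`). With `y_i = x_i
u^i`, a positive necklace contributes `1/(1 - y_p)` and a negative one `(1 + y_p)/(1 - y_{2p})`.

Möbius inversion over odd divisors gives `f_{d,m}` negative necklaces of period `d`, and `f_{d,m} -
f_{d/2,m}` positive ones, the last term only for even `d` (`wordCount_neg`, `wordCount_pos`). The
factors `1/(1 - y_{2p})` make up the deficit, which leaves the stated product (`prod_necklace_eq`).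

Valleys become peaks under conjugation by the order reversal, which keeps the cycle type. All
products are handled modulo `u^(N+1)`, where only finitely many factors matter. -/

/-! ### Compatible words over an alternating alphabet -/

/-- The sign of a letter: even letters are negative, odd letters are positive. -/
def altSign (c : ℕ) : ℤ := (-1) ^ (c + 1)

/-- A word `b` is compatible with the sequence `v` if `b` is weakly increasing and `v` increases
along the blocks of `b` with a positive letter and decreases along the others. -/
def Compatible {n : ℕ} (b : Fin n → ℕ) (v : Fin n → ℤ) : Prop :=
  StrictMono fun j => toLex (b j, altSign (b j) * v j)

theorem altSign_even (k : ℕ) : altSign (2 * k) = -1 := by simp [altSign, pow_succ, pow_mul]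

theorem altSign_odd (k : ℕ) : altSign (2 * k + 1) = 1 := by
  simp [altSign, pow_succ, pow_mul]

theorem Compatible.monotone {n : ℕ} {b : Fin n → ℕ} {v : Fin n → ℤ} (h : Compatible b v) :
    Monotone b := fun i j hij => by
  rcases Prod.Lex.toLex_le_toLex.1 (StrictMono.monotone h hij) with h | h
  · exact h.le
  · exact h.1.le

theorem strictMono_fin_succ_iff {α : Type*} [Preorder α] {n : ℕ} {f : Fin (n + 2) → α} :
    StrictMono f ↔ StrictMono (fun j : Fin (n + 1) => f j.castSucc) ∧
      f (Fin.last n).castSucc < f (Fin.last (n + 1)) := by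
  rw [Fin.strictMono_iff_lt_succ, Fin.strictMono_iff_lt_succ, Fin.forall_fin_succ']
  simp only [Fin.succ_last, Fin.succ_castSucc]

open Classical in
/-- The words over `{0, …, c - 1}` compatible with the first `n` terms of `v`. -/
noncomputable def compatWords (v : ℕ → ℤ) (n c : ℕ) : Finset (Fin n → ℕ) :=
  (Fintype.piFinset fun _ => Finset.range c).filter fun b => Compatible b fun j => v j

theorem mem_compatWords {v : ℕ → ℤ} {n c : ℕ} {b : Fin n → ℕ} :
    b ∈ compatWords v n c ↔ (∀ j, b j < c) ∧ Compatible b fun j => v j := by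
  simp [compatWords]

theorem mem_compatWords_succ {v : ℕ → ℤ} {n c : ℕ} {b : Fin (n + 1) → ℕ} :
    b ∈ compatWords v (n + 1) c ↔ b (Fin.last n) < c ∧ Compatible b fun j => v j := by
  rw [mem_compatWords]
  exact ⟨fun h => ⟨h.1 _, h.2⟩, fun h => ⟨fun j => (h.2.monotone (Fin.le_last j)).trans_lt h.1, h.2⟩⟩

theorem card_compatWords_zero (v : ℕ → ℤ) (n : ℕ) : (compatWords v (n + 1) 0).card = 0 := by
  rw [Finset.card_eq_zero, Finset.eq_empty_iff_forall_notMem]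
  intro b hb
  simp [mem_compatWords_succ] at hb

theorem card_compatWords_one (v : ℕ → ℤ) (c : ℕ) : (compatWords v 1 c).card = c := by
  have : compatWords v 1 c = Fintype.piFinset fun _ => Finset.range c := by
    ext b
    simp only [mem_compatWords, Fintype.mem_piFinset, Finset.mem_range, and_iff_left_iff_imp]
    intro _ i j hij
    exact absurd hij (by rw [Subsingleton.elim i j]; exact lt_irrefl _)
  rw [this]
  simp

/-- Split by whether the last letter is `c`. If it is, deleting it leaves a word that may itself end
in `c` exactly when the last step of `v` goes in the direction prescribed by the sign of `c`. -/
theorem card_compatWords_step (v : ℕ → ℤ) (n c : ℕ) :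
    (compatWords v (n + 2) (c + 1)).card = (compatWords v (n + 2) c).card +
      (compatWords v (n + 1) (if altSign c * v n < altSign c * v (n + 1) then c + 1 else c)).card := by
  classical
  have hsplit : compatWords v (n + 2) (c + 1) = compatWords v (n + 2) c ∪
      (compatWords v (n + 2) (c + 1)).filter fun b => b (Fin.last _) = c := by
    ext b
    simp only [mem_compatWords_succ, Finset.mem_union, Finset.mem_filter]
    constructor
    · rintro ⟨h1, h2⟩
      rcases Nat.lt_succ_iff_lt_or_eq.1 h1 with h | h
      · exact Or.inl ⟨h, h2⟩
      · exact Or.inr ⟨⟨h1, h2⟩, h⟩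
    · rintro (h | h)
      · exact ⟨h.1.trans (Nat.lt_succ_self _), h.2⟩
      · exact h.1
  rw [hsplit, Finset.card_union_of_disjoint]
  · congr 1
    refine Finset.card_nbij' (fun b j => b j.castSucc) (fun b => Fin.snoc b c) ?_ ?_ ?_ ?_
    · intro b hb
      simp only [Finset.coe_filter, Set.mem_ofPred_eq, mem_compatWords_succ, Compatible,
        strictMono_fin_succ_iff (n := n)] at hb
      obtain ⟨⟨-, h1, h2⟩, h3⟩ := hb
      simp only [Finset.mem_coe, mem_compatWords_succ]
      refine ⟨?_, h1⟩
      rw [Prod.Lex.toLex_lt_toLex] at h2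
      simp only [h3, Fin.val_castSucc, Fin.val_last] at h2
      rcases h2 with h2 | ⟨h2, h4⟩
      · split_ifs <;> omega
      · rw [h2] at h4
        rw [if_pos h4]
        omega
    · intro b hb
      simp only [Finset.mem_coe, mem_compatWords_succ] at hb
      simp only [Finset.coe_filter, Set.mem_ofPred_eq, mem_compatWords_succ, Compatible,
        strictMono_fin_succ_iff (n := n), Fin.snoc_last, Fin.snoc_castSucc, and_true]
      refine ⟨Nat.lt_succ_self _, hb.2, ?_⟩
      rw [Prod.Lex.toLex_lt_toLex]
      simp only [Fin.val_castSucc, Fin.val_last]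
      have h1 := hb.1
      split_ifs at h1 with h
      · rcases Nat.lt_succ_iff_lt_or_eq.1 h1 with h2 | h2
        · exact Or.inl h2
        · exact Or.inr ⟨h2, by rw [h2]; exact h⟩
      · exact Or.inl h1
    · intro b hb
      simp only [Finset.coe_filter, Set.mem_ofPred_eq] at hb
      rw [← hb.2]
      exact Fin.snoc_init_self b
    · intro b _
      funext j
      simp
  · rw [Finset.disjoint_left]
    intro b hb hb'
    have h1 := (mem_compatWords_succ.1 hb).1
    have h2 := (Finset.mem_filter.1 hb').2
    omega

/-! ### The generating function of compatible words -/

/-- The number of peaks among the terms `v 0, …, v n`. -/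
def peaksUpTo (v : ℕ → ℤ) (n : ℕ) : ℕ :=
  ((Finset.range n).filter fun i => 0 < i ∧ v (i - 1) < v i ∧ v (i + 1) < v i).card

theorem peaksUpTo_succ (v : ℕ → ℤ) (n : ℕ) : peaksUpTo v (n + 1) = peaksUpTo v n +
    if 0 < n ∧ v (n - 1) < v n ∧ v (n + 1) < v n then 1 else 0 := by
  rw [peaksUpTo, peaksUpTo, Finset.range_add_one, Finset.filter_insert]
  split_ifs
  · rw [Finset.card_insert_of_notMem (by simp)]
  · rfl

section
variable (K : Type*) [Field K]
open PowerSeries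

/-- The generating function of the number of compatible words over `2k` letters. -/
noncomputable def evenSeries (v : ℕ → ℤ) (n : ℕ) : PowerSeries K :=
  PowerSeries.mk fun k => ((compatWords v n (2 * k)).card : K)

/-- The generating function of the number of compatible words over `2k + 1` letters. -/
noncomputable def oddSeries (v : ℕ → ℤ) (n : ℕ) : PowerSeries K :=
  PowerSeries.mk fun k => ((compatWords v n (2 * k + 1)).card : K)

/-- There are `c` words of length one over `c` letters. The second relation is the one that also
holds after a descent, so a sequence starts as if it came from a descent. -/
theorem series_one (v : ℕ → ℤ) : (1 - X) ^ 2 * evenSeries K v 1 = 2 * X ∧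
    (1 + X) * evenSeries K v 1 = 2 * X * oddSeries K v 1 := by
  have h0 : evenSeries K v 1 + (evenSeries K v 1 * X) = 2 * (oddSeries K v 1 * X) := by
    ext k
    rw [two_mul]
    rcases k with _ | k
    · simp [evenSeries, oddSeries, card_compatWords_one]
    · simp [coeff_succ_mul_X, evenSeries, oddSeries, card_compatWords_one]
      ring
  have h1 : evenSeries K v 1 - (evenSeries K v 1 * X) = 2 * (mk 1 * X) := by
    ext k
    rw [two_mul]
    rcases k with _ | k
    · simp [evenSeries, card_compatWords_one]
    · simp [coeff_succ_mul_X, evenSeries, card_compatWords_one]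
      ring
  have h2 : (mk 1 : PowerSeries K) * (1 - X) = 1 := mk_one_mul_one_sub_eq_one K
  constructor
  · linear_combination (1 - X) * h1 + 2 * X * h2
  · linear_combination h0

/-- Add the letters `2k` (negative) and `2k + 1` (positive) in turn. On an ascent only the positive
letter can be repeated, which gives two linear relations between the old and new series. For a
descent the roles are exchanged. -/
theorem series_ascent (v : ℕ → ℤ) (n : ℕ) (h : v n < v (n + 1)) :
    (1 - X) * evenSeries K v (n + 2) = (1 + X) * evenSeries K v (n + 1) ∧
    (1 + X) * oddSeries K v (n + 2) = 2 * evenSeries K v (n + 2) := by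
  have h0 : oddSeries K v (n + 2) = evenSeries K v (n + 2) + evenSeries K v (n + 1) := by
    ext k
    simp only [evenSeries, oddSeries, coeff_mk, map_add]
    rw [card_compatWords_step, altSign_even, if_neg (by linarith)]
    push_cast
    ring
  have h1 : evenSeries K v (n + 2) = oddSeries K v (n + 2) * X + evenSeries K v (n + 1) := by
    ext k
    rcases k with _ | k
    · simp [evenSeries, card_compatWords_zero]
    · simp only [map_add, coeff_succ_mul_X, evenSeries, oddSeries, coeff_mk]
      rw [show 2 * (k + 1) = 2 * k + 1 + 1 by ring, card_compatWords_step v n (2 * k + 1),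
        altSign_odd, if_pos (by linarith)]
      push_cast
      ring
  constructor
  · linear_combination h1 + X * h0
  · linear_combination h0 - h1

theorem series_descent (v : ℕ → ℤ) (n : ℕ) (h : v (n + 1) < v n) :
    (1 - X) * evenSeries K v (n + 2) = 2 * X * oddSeries K v (n + 1) ∧
    (1 + X) * evenSeries K v (n + 2) = 2 * X * oddSeries K v (n + 2) := by
  have h0 : oddSeries K v (n + 2) = evenSeries K v (n + 2) + oddSeries K v (n + 1) := by
    ext k
    simp only [evenSeries, oddSeries, coeff_mk, map_add]
    rw [card_compatWords_step, altSign_even, if_pos (by linarith)]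
    push_cast
    ring
  have h1 : evenSeries K v (n + 2) = oddSeries K v (n + 2) * X + oddSeries K v (n + 1) * X := by
    ext k
    rcases k with _ | k
    · simp [evenSeries, card_compatWords_zero]
    · simp only [map_add, coeff_succ_mul_X, evenSeries, oddSeries, coeff_mk]
      rw [show 2 * (k + 1) = 2 * k + 1 + 1 by ring, card_compatWords_step v n (2 * k + 1),
        altSign_odd, if_neg (by linarith)]
      push_cast
      ring
  constructor
  · linear_combination h1 + X * h0
  · linear_combination h1 - X * h0

/-- Every step multiplies the even series by `(1 + X)/(1 - X)`, and a descent right after an ascent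
brings the further factor `4X/(1 + X)^2`. The second conjunct records how the odd series follows
from the even one, which depends only on the direction of the last step. -/
theorem evenSeries_formula (v : ℕ → ℤ) (n : ℕ) (hv : ∀ i < n, v i ≠ v (i + 1)) :
    (1 - X) ^ (n + 2) * (1 + X) ^ (2 * peaksUpTo v n + 2) * (2 * evenSeries K v (n + 1)) =
      (1 + X) ^ (n + 2) * (4 * X) ^ (peaksUpTo v n + 1) ∧
    (if 0 < n ∧ v (n - 1) < v n then (1 + X) * oddSeries K v (n + 1) = 2 * evenSeries K v (n + 1)
      else (1 + X) * evenSeries K v (n + 1) = 2 * X * oddSeries K v (n + 1)) := by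
  induction n with
  | zero =>
    obtain ⟨h1, h2⟩ := series_one K v
    refine ⟨?_, by simpa using h2⟩
    simp only [peaksUpTo, Finset.range_zero, Finset.filter_empty, Finset.card_empty]
    linear_combination 2 * (1 + X) ^ 2 * h1
  | succ n ih =>
    obtain ⟨ih1, ih2⟩ := ih fun i hi => hv i (by omega)
    rw [peaksUpTo_succ]
    set p := peaksUpTo v n
    rcases lt_or_gt_of_ne (hv n (by omega)) with h | h
    · obtain ⟨h1, h2⟩ := series_ascent K v n h
      rw [if_neg (by intro h'; exact absurd h'.2.2 (by linarith)),
        if_pos ⟨Nat.succ_pos n, by simpa using h⟩]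
      refine ⟨?_, h2⟩
      linear_combination (1 - X) ^ (n + 2) * (1 + X) ^ (2 * p + 2) * 2 * h1 + (1 + X) * ih1
    · obtain ⟨h1, h2⟩ := series_descent K v n h
      rw [if_neg (c := 0 < n + 1 ∧ v (n + 1 - 1) < v (n + 1))
        (by intro h'; simp only [Nat.add_sub_cancel] at h'; linarith [h'.2])]
      refine ⟨?_, h2⟩
      by_cases hn : 0 < n ∧ v (n - 1) < v n
      · rw [if_pos hn] at ih2
        rw [if_pos ⟨hn.1, hn.2, h⟩]
        linear_combination (1 - X) ^ (n + 2) * (1 + X) ^ (2 * p + 4) * 2 * h1 +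
          (1 - X) ^ (n + 2) * (1 + X) ^ (2 * p + 3) * (4 * X) * ih2 + 4 * X * (1 + X) * ih1
      · rw [if_neg hn] at ih2
        rw [if_neg (by tauto)]
        linear_combination (1 - X) ^ (n + 2) * (1 + X) ^ (2 * p + 2) * 2 * h1 -
          (1 - X) ^ (n + 2) * (1 + X) ^ (2 * p + 2) * 2 * ih2 + (1 + X) * ih1

end

/-! ### Specialization to permutations -/

/-- The one-line notation of a permutation, continued by `0`. -/
def permSeq {n : ℕ} (w : Equiv.Perm (Fin n)) (i : ℕ) : ℤ :=
  if h : i < n then (w ⟨i, h⟩ : ℕ) else 0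

theorem permSeq_val {n : ℕ} (w : Equiv.Perm (Fin n)) (j : Fin n) :
    permSeq w j = (w j : ℕ) := by
  simp [permSeq]

theorem permSeq_ne {n : ℕ} (w : Equiv.Perm (Fin (n + 1))) (i : ℕ) (hi : i < n) :
    permSeq w i ≠ permSeq w (i + 1) := by
  rw [permSeq, permSeq, dif_pos (by omega), dif_pos (by omega)]
  intro h
  have := w.injective (Fin.ext (Nat.cast_injective (R := ℤ) h))
  simp at this

theorem peaksUpTo_permSeq {n : ℕ} (w : Equiv.Perm (Fin (n + 1))) :
    peaksUpTo (permSeq w) n = peakCount w := by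
  refine Finset.card_bij' (fun i _ => (Fin.ofNat (n + 1) i)) (fun i _ => (i : ℕ)) ?_ ?_ ?_ ?_
  · intro i hi
    simp only [Finset.mem_filter, Finset.mem_range] at hi
    obtain ⟨h1, h2, h3, h4⟩ := hi
    have e : (Fin.ofNat (n + 1) i) = ⟨i, by omega⟩ := by
      ext; simp [Nat.mod_eq_of_lt (show i < n + 1 by omega)]
    rw [e]
    rw [permSeq, permSeq, dif_pos (by omega), dif_pos (by omega)] at h3 h4
    simp only [Finset.mem_filter, Finset.mem_univ, true_and]
    refine ⟨⟨i - 1, by omega⟩, ⟨i + 1, by omega⟩, by simp; omega, rfl, ?_, ?_⟩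
    · exact_mod_cast h3
    · exact_mod_cast h4
  · intro i hi
    simp only [Finset.mem_filter, Finset.mem_univ, true_and] at hi
    obtain ⟨a, b, ha, hb, h1, h2⟩ := hi
    simp only [Finset.mem_filter, Finset.mem_range]
    refine ⟨by omega, by omega, ?_, ?_⟩
    · rw [show (i : ℕ) - 1 = a by omega, permSeq_val, permSeq_val]
      exact_mod_cast h1
    · rw [hb, permSeq_val, permSeq_val]
      exact_mod_cast h2
  · intro i hi
    simp only [Finset.mem_filter, Finset.mem_range] at hi
    simp [Nat.mod_eq_of_lt (show i < n + 1 by omega)]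
  · intro i _
    ext
    simp

theorem evenSeries_permSeq (K : Type*) [Field K] [CharZero K] {n : ℕ} (hn : 0 < n)
    (w : Equiv.Perm (Fin n)) :
    PowerSeries.C (1 / 2 : K) * ((1 + PowerSeries.X) ^ (n + 1) *
      ((1 - PowerSeries.X) ^ (n + 1))⁻¹) *
      (4 * PowerSeries.X * ((1 + PowerSeries.X) ^ 2)⁻¹) ^ (peakCount w + 1) =
    evenSeries K (permSeq w) n := by
  obtain ⟨n, rfl⟩ := Nat.exists_eq_succ_of_ne_zero hn.ne'
  have h := (evenSeries_formula K (permSeq w) n (permSeq_ne w)).1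
  rw [peaksUpTo_permSeq] at h
  set p := peakCount w
  have h1 : (1 - PowerSeries.X : PowerSeries K) ^ (n.succ + 1) *
      ((1 - PowerSeries.X) ^ (n.succ + 1))⁻¹ = 1 := PowerSeries.mul_inv_cancel _ (by simp)
  have h2 : (1 + PowerSeries.X : PowerSeries K) ^ 2 *
      ((1 + PowerSeries.X) ^ 2)⁻¹ = 1 := PowerSeries.mul_inv_cancel _ (by simp)
  have h3 : PowerSeries.C (1 / 2 : K) * 2 = 1 := by
    rw [show (2 : PowerSeries K) = PowerSeries.C 2 from (map_ofNat _ 2).symm, ← map_mul]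
    simp
  have h4 : ((1 + PowerSeries.X : PowerSeries K) ^ 2) ^ (p + 1) *
      (((1 + PowerSeries.X) ^ 2)⁻¹) ^ (p + 1) = 1 := by rw [← mul_pow, h2, one_pow]
  rw [show 2 * p + 2 = 2 * (p + 1) by ring, pow_mul] at h
  change _ = evenSeries K (permSeq w) (n + 1)
  set A := ((1 - PowerSeries.X : PowerSeries K) ^ (n.succ + 1))⁻¹
  set B := ((1 + PowerSeries.X : PowerSeries K) ^ 2)⁻¹
  set E := evenSeries K (permSeq w) (n + 1)
  set c := PowerSeries.C (1 / 2 : K)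
  rw [mul_pow (4 * PowerSeries.X)]
  have h5 : (1 + PowerSeries.X : PowerSeries K) ^ (n.succ + 1) * (4 * PowerSeries.X) ^ (p + 1) =
      (1 - PowerSeries.X) ^ (n.succ + 1) * ((1 + PowerSeries.X) ^ 2) ^ (p + 1) * (2 * E) := h.symm
  calc _ = c * A * B ^ (p + 1) * ((1 + PowerSeries.X : PowerSeries K) ^ (n.succ + 1) *
        (4 * PowerSeries.X) ^ (p + 1)) := by ring
    _ = (c * 2) * ((1 - PowerSeries.X) ^ (n.succ + 1) * A) *
        (((1 + PowerSeries.X) ^ 2) ^ (p + 1) * B ^ (p + 1)) * E := by rw [h5]; ring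
    _ = E := by rw [h3, h1, h4]; ring

theorem altSign_eq_or (c : ℕ) : altSign c = 1 ∨ altSign c = -1 := by
  rw [altSign]
  exact neg_one_pow_eq_or ℤ _

theorem eq_of_monotone_of_map_univ_eq {α : Type*} [LinearOrder α] {n : ℕ} {f g : Fin n → α}
    (hf : Monotone f) (hg : Monotone g)
    (h : Finset.univ.val.map f = Finset.univ.val.map g) : f = g := by
  have h1 : (List.ofFn f).Perm (List.ofFn g) := by
    rw [← Multiset.coe_eq_coe]
    simpa [Fin.univ_val_map] using h
  have h2 : (List.ofFn f) = List.ofFn g :=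
    h1.eq_of_pairwise' (List.pairwise_ofFn.2 fun i j hij => hf hij.le)
      (List.pairwise_ofFn.2 fun i j hij => hg hij.le)
  exact List.ofFn_injective h2

/-! ### The twisted order on infinite words -/

section Words
variable {c : ℕ}

/-- The product of the signs of the first `k` letters. -/
def signProd (z : ℕ → Fin c) (k : ℕ) : ℤ := ∏ i ∈ Finset.range k, altSign (z i)

theorem signProd_zero (z : ℕ → Fin c) : signProd z 0 = 1 := by simp [signProd]

theorem signProd_succ' (z : ℕ → Fin c) (k : ℕ) :
    signProd z (k + 1) = altSign (z 0) * signProd (fun i => z (i + 1)) k := by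
  rw [signProd, Finset.prod_range_succ', mul_comm, signProd]

theorem signProd_congr {z y : ℕ → Fin c} {k : ℕ} (h : ∀ i < k, z i = y i) :
    signProd z k = signProd y k :=
  Finset.prod_congr rfl fun i hi => by rw [h i (Finset.mem_range.1 hi)]

theorem signProd_eq_or (z : ℕ → Fin c) (k : ℕ) : signProd z k = 1 ∨ signProd z k = -1 := by
  induction k with
  | zero => exact Or.inl (signProd_zero z)
  | succ k ih =>
    rw [signProd, Finset.prod_range_succ, ← signProd]
    rcases ih with h | h <;> rcases altSign_eq_or (z k) with h' | h' <;> simp [h, h']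

theorem signProd_ne_zero (z : ℕ → Fin c) (k : ℕ) : signProd z k ≠ 0 := by
  rcases signProd_eq_or z k with h | h <;> simp [h]

/-- The encoding of infinite words whose lexicographic order is the twisted order of words:
each negative letter reverses the comparison of the later letters. -/
def twist (z : ℕ → Fin c) : Lex (ℕ → ℤ) := toLex fun k => signProd z k * (z k : ℕ)

/-- Letters are recovered one at a time: equal earlier letters give equal sign products, which are
nonzero and cancel. -/
theorem eq_of_twist_eq_of_lt {z y : ℕ → Fin c} {k : ℕ}
    (h : ∀ i < k, signProd z i * (z i : ℕ) = signProd y i * (y i : ℕ)) : ∀ i < k, z i = y i := by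
  intro i
  induction i using Nat.strong_induction_on with
  | _ i ih =>
    intro hi
    have h1 := h i hi
    rw [signProd_congr fun j hj => ih j hj (hj.trans hi)] at h1
    exact Fin.ext (Nat.cast_injective (R := ℤ) (mul_left_cancel₀ (signProd_ne_zero _ _) h1))

theorem twist_injective : Function.Injective (twist (c := c)) := by
  intro z y h
  funext k
  refine eq_of_twist_eq_of_lt (k := k + 1) (fun i _ => ?_) k (Nat.lt_succ_self k)
  exact congrFun (toLex.injective h) i

theorem twist_lt_iff {z y : ℕ → Fin c} : twist z < twist y ↔
    ∃ k, (∀ i < k, z i = y i) ∧ signProd z k * (z k : ℕ) < signProd z k * (y k : ℕ) := by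
  constructor
  · rintro ⟨k, h1, h2⟩
    have h3 := eq_of_twist_eq_of_lt h1
    refine ⟨k, h3, ?_⟩
    change signProd z k * (z k : ℕ) < signProd y k * (y k : ℕ) at h2
    rwa [← signProd_congr h3] at h2
  · rintro ⟨k, h1, h2⟩
    refine ⟨k, fun i hi => ?_, ?_⟩
    · change signProd z i * (z i : ℕ) = signProd y i * (y i : ℕ)
      rw [signProd_congr fun j hj => h1 j (hj.trans hi), h1 i hi]
    · change signProd z k * (z k : ℕ) < signProd y k * (y k : ℕ)
      rwa [← signProd_congr h1]

theorem head_le_of_twist_le {z y : ℕ → Fin c} (h : twist z ≤ twist y) : z 0 ≤ y 0 := by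
  rcases h.lt_or_eq with h | h
  · obtain ⟨k, h1, h2⟩ := twist_lt_iff.1 h
    rcases k with _ | k
    · simp only [signProd_zero, one_mul, Nat.cast_lt] at h2
      exact h2.le
    · exact (h1 0 (Nat.succ_pos k)).le
  · rw [twist_injective h]

/-- Deleting the first letter removes its sign from every later sign product. So a common positive
head preserves the comparison of the tails, and a negative one reverses it, as in the next lemma. -/
theorem twist_tail_le_of_altSign_eq_one {z y : ℕ → Fin c} (h : twist z ≤ twist y)
    (h0 : z 0 = y 0) (hs : altSign (z 0) = 1) :
    twist (fun i => z (i + 1)) ≤ twist (fun i => y (i + 1)) := by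
  rcases h.lt_or_eq with h | h
  · obtain ⟨k, h1, h2⟩ := twist_lt_iff.1 h
    rcases k with _ | k
    · simp [signProd_zero, h0] at h2
    · rw [signProd_succ', hs, one_mul] at h2
      exact (twist_lt_iff.2 ⟨k, fun i hi => h1 (i + 1) (Nat.succ_lt_succ hi), h2⟩).le
  · rw [twist_injective h]

theorem twist_tail_le_of_altSign_eq_neg_one {z y : ℕ → Fin c} (h : twist z ≤ twist y)
    (h0 : z 0 = y 0) (hs : altSign (z 0) = -1) :
    twist (fun i => y (i + 1)) ≤ twist (fun i => z (i + 1)) := by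
  rcases h.lt_or_eq with h | h
  · obtain ⟨k, h1, h2⟩ := twist_lt_iff.1 h
    rcases k with _ | k
    · simp [signProd_zero, h0] at h2
    · rw [signProd_succ', hs] at h2
      refine (twist_lt_iff.2 ⟨k, fun i hi => (h1 (i + 1) (Nat.succ_lt_succ hi)).symm, ?_⟩).le
      rw [← signProd_congr fun i hi => h1 (i + 1) (Nat.succ_lt_succ hi)]
      linarith
  · rw [twist_injective h]

/-! ### Compatible pairs and shift-invariant multisets of words -/

section Itinerary
variable {n : ℕ}

/-- A word and a permutation that are compatible. -/
def CompatiblePair (b : Fin n → Fin c) (v : Equiv.Perm (Fin n)) : Prop :=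
  Compatible (fun j => (b j : ℕ)) fun j => ((v j : ℕ) : ℤ)

/-- The letters met along the orbit of `j`. -/
def itinerary (b : Fin n → Fin c) (v : Equiv.Perm (Fin n)) (j : Fin n) (k : ℕ) : Fin c :=
  b ((v ^ k) j)

theorem itinerary_zero (b : Fin n → Fin c) (v : Equiv.Perm (Fin n)) (j : Fin n) :
    itinerary b v j 0 = b j := rfl

theorem itinerary_apply (b : Fin n → Fin c) (v : Equiv.Perm (Fin n)) (j : Fin n) :
    itinerary b v (v j) = fun k => itinerary b v j (k + 1) := by
  funext k
  simp [itinerary, pow_succ]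

variable {b : Fin n → Fin c} {v : Equiv.Perm (Fin n)}

theorem CompatiblePair.lt_iff (h : CompatiblePair b v) {i j : Fin n} (hb : b i = b j) :
    i < j ↔ altSign (b i) * ((v i : ℕ) : ℤ) < altSign (b i) * ((v j : ℕ) : ℤ) := by
  rw [← StrictMono.lt_iff_lt h]
  simp only [Prod.Lex.toLex_lt_toLex, hb, lt_irrefl, false_or, true_and]

/-- Suppose two itineraries first differ at index `k`. As long as the letters agree, each
application of `v` preserves or reverses the order of the two positions according to the sign of the
letter. At index `k` monotonicity of `b` decides, and the twist records the accumulated sign. -/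
theorem CompatiblePair.monotone_twist (h : CompatiblePair b v) :
    Monotone fun j => twist (itinerary b v j) := by
  have key : ∀ k (i j : Fin n), (∀ l < k, itinerary b v i l = itinerary b v j l) →
      signProd (itinerary b v i) k * (itinerary b v i k : ℕ) <
        signProd (itinerary b v i) k * (itinerary b v j k : ℕ) → i < j := by
    intro k
    induction k with
    | zero =>
      intro i j _ hlt
      simp only [signProd_zero, one_mul, Nat.cast_lt, itinerary_zero] at hlt
      by_contra hij
      exact absurd (Compatible.monotone h (not_lt.1 hij)) (not_le.2 hlt)
    | succ k ih =>
      intro i j heq hlt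
      have h0 : b i = b j := heq 0 (Nat.succ_pos k)
      rw [h.lt_iff h0]
      rw [signProd_succ', ← itinerary_apply, itinerary_zero] at hlt
      have heq' : ∀ l < k, itinerary b v (v i) l = itinerary b v (v j) l := fun l hl => by
        rw [itinerary_apply, itinerary_apply]
        exact heq (l + 1) (Nat.succ_lt_succ hl)
      have e : ∀ i, itinerary b v i (k + 1) = itinerary b v (v i) k := fun i => by
        rw [itinerary_apply]
      rw [e, e] at hlt
      rcases altSign_eq_or (b i) with hs | hs
      · rw [hs, one_mul] at hlt
        rw [hs, one_mul, one_mul]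
        exact_mod_cast ih _ _ heq' hlt
      · rw [hs] at hlt
        rw [hs, neg_one_mul, neg_one_mul, neg_lt_neg_iff]
        have := ih (v j) (v i) (fun l hl => (heq' l hl).symm) (by
          rw [← signProd_congr heq']; linarith)
        exact_mod_cast this
  intro i j hij
  by_contra hlt
  obtain ⟨k, h1, h2⟩ := twist_lt_iff.1 (not_le.1 hlt)
  exact absurd (key k j i h1 h2) (not_lt.2 hij)

theorem itinerary_periodic {L : ℕ} (hL : n.factorial ∣ L) (j : Fin n) :
    Function.Periodic (itinerary b v j) L := by
  intro k
  obtain ⟨d, rfl⟩ := hL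
  have : v ^ n.factorial = 1 := by
    have := pow_card_eq_one (x := v)
    rwa [Fintype.card_perm, Fintype.card_fin] at this
  simp [itinerary, pow_add, pow_mul, this]

/-- The lost first letter returns after one period, since itineraries are periodic. -/
theorem itinerary_tail_injective {i j : Fin n}
    (h : itinerary b v (v i) = itinerary b v (v j)) : itinerary b v i = itinerary b v j := by
  have hper := fun j => itinerary_periodic (b := b) (v := v) (dvd_refl n.factorial) j
  have hpos := Nat.factorial_pos n
  funext k
  rw [← hper i k, ← hper j k, show k + n.factorial = (k + (n.factorial - 1)) + 1 by omega]
  rw [itinerary_apply, itinerary_apply] at h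
  exact congrFun h _

/-- The key that is sorted by the inverse of a permutation compatible with a word. -/
def sortKey (f : Fin n → ℕ → Fin c) (j : Fin n) : Lex (ℕ → ℤ) ×ₗ ℤ :=
  toLex (twist fun k => f j (k + 1), altSign (f j 0) * ((j : ℕ) : ℤ))

/-- The itinerary of `v i` is the tail of the itinerary of `i`, so sorting positions by their words
sorts preimages by their tails. Equal tails force equal itineraries, and then the sign of the common
letter decides the tie. -/
theorem CompatiblePair.strictMono_sortKey (h : CompatiblePair b v) :
    StrictMono fun j => sortKey (itinerary b v) (v⁻¹ j) := by
  intro i j hij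
  obtain ⟨i, rfl⟩ := v.surjective i
  obtain ⟨j, rfl⟩ := v.surjective j
  have hinv : ∀ i, v⁻¹ (v i) = i := v.symm_apply_apply
  simp only [hinv, sortKey, Prod.Lex.toLex_lt_toLex, itinerary_zero]
  rw [← itinerary_apply, ← itinerary_apply]
  rcases (h.monotone_twist hij.le).lt_or_eq with hlt | heq
  · exact Or.inl hlt
  · refine Or.inr ⟨heq, ?_⟩
    have h0 : b i = b j := congrFun (itinerary_tail_injective (twist_injective heq)) 0
    have h1 := h.lt_iff h0
    have h2 := h.lt_iff h0.symm
    rw [← h0] at h2 ⊢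
    rcases altSign_eq_or (b i) with hs | hs
    · rw [hs, one_mul, one_mul] at h1 ⊢
      exact_mod_cast h1.2 (by exact_mod_cast hij)
    · rw [hs, neg_one_mul, neg_one_mul, neg_lt_neg_iff] at h2 ⊢
      exact_mod_cast h2.2 (by exact_mod_cast hij)

/-- A multiset has one weakly increasing listing, so the itineraries are known in order, and `b` is
the list of their heads. The sort keys depend on the itineraries only and are distinct, so `v⁻¹` is
the unique permutation that sorts them. -/
theorem CompatiblePair.eq_of_map_itinerary_eq {b' : Fin n → Fin c} {v' : Equiv.Perm (Fin n)}
    (h : CompatiblePair b v) (h' : CompatiblePair b' v')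
    (hmap : Finset.univ.val.map (itinerary b v) = Finset.univ.val.map (itinerary b' v')) :
    b = b' ∧ v = v' := by
  have h1 : itinerary b v = itinerary b' v' := by
    have := eq_of_monotone_of_map_univ_eq h.monotone_twist h'.monotone_twist (by
      have := congrArg (Multiset.map twist) hmap
      rwa [Multiset.map_map, Multiset.map_map] at this)
    funext j
    exact twist_injective (congrFun this j)
  refine ⟨funext fun j => congrFun (congrFun h1 j) 0, ?_⟩
  have h2 := h'.strictMono_sortKey
  have h3 := h.strictMono_sortKey
  rw [← h1] at h2
  have hperm : ∀ w : Equiv.Perm (Fin n), Finset.univ.val.map (fun j => sortKey (itinerary b v) (w j))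
      = Finset.univ.val.map (sortKey (itinerary b v)) := by
    intro w
    have : Finset.univ.val.map w = (Finset.univ : Finset (Fin n)).val := by
      have := congrArg Finset.val (Finset.map_univ_equiv w)
      rwa [Finset.map_val] at this
    conv_rhs => rw [← this, Multiset.map_map]
    rfl
  have h4 := eq_of_monotone_of_map_univ_eq h3.monotone h2.monotone ((hperm _).trans (hperm _).symm)
  have hinj : Function.Injective (sortKey (itinerary b v)) := by
    have := h3.injective.comp v.injective
    simpa [Function.comp_def] using this
  have h5 : v⁻¹ = v'⁻¹ := Equiv.ext fun j => hinj (congrFun h4 j)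
  exact inv_injective h5

/-- Every multiset of words that is invariant under the shift comes from a compatible pair. -/
theorem exists_compatiblePair (f : Fin n → ℕ → Fin c)
    (hf : Finset.univ.val.map (fun j k => f j (k + 1)) = Finset.univ.val.map f) :
    ∃ (b : Fin n → Fin c) (v : Equiv.Perm (Fin n)), CompatiblePair b v ∧
      Finset.univ.val.map (itinerary b v) = Finset.univ.val.map f := by
  have hperm : ∀ {β : Type} (g : Fin n → β) (w : Equiv.Perm (Fin n)),
      Finset.univ.val.map (fun j => g (w j)) = Finset.univ.val.map g := by
    intro β g w
    have : Finset.univ.val.map w = (Finset.univ : Finset (Fin n)).val := by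
      have := congrArg Finset.val (Finset.map_univ_equiv w)
      rwa [Finset.map_val] at this
    conv_rhs => rw [← this, Multiset.map_map]
    rfl
  -- Positions must carry the words in twisted order.
  set ρ := Tuple.sort fun j => twist (f j)
  have hmono : Monotone fun j => twist (f (ρ j)) := Tuple.monotone_sort fun j => twist (f j)
  set g : Fin n → ℕ → Fin c := fun j => f (ρ j) with hg
  have hgf : Finset.univ.val.map g = Finset.univ.val.map f := hperm f ρ
  have hgt : Finset.univ.val.map (fun j k => g j (k + 1)) = Finset.univ.val.map g :=
    (hperm (fun j k => f j (k + 1)) ρ).trans (hf.trans hgf.symm)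
  -- This choice of `v⁻¹` is forced by `CompatiblePair.strictMono_sortKey`.
  set τ := Tuple.sort (sortKey g)
  have hτ : Monotone fun j => sortKey g (τ j) := Tuple.monotone_sort (sortKey g)
  -- By shift invariance the tails form the same multiset as the words; both listings are
  -- increasing, hence equal. So `τ⁻¹` acts on the words as the shift.
  have h1 : (fun j => twist fun k => g (τ j) (k + 1)) = fun j => twist (g j) := by
    refine eq_of_monotone_of_map_univ_eq (fun i j hij => ?_) hmono ?_
    · rcases Prod.Lex.toLex_le_toLex.1 (hτ hij) with h | h
      · exact h.le
      · exact h.1.le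
    · rw [hperm (fun j => twist fun k => g j (k + 1)) τ]
      have := congrArg (Multiset.map twist) hgt
      rwa [Multiset.map_map, Multiset.map_map] at this
  have h2 : ∀ j, g (τ⁻¹ j) = fun k => g j (k + 1) := by
    intro j
    have := twist_injective (congrFun h1 (τ⁻¹ j))
    simpa using this.symm
  have h3 : ∀ i j, sortKey g i < sortKey g j → τ⁻¹ i < τ⁻¹ j := by
    intro i j hij
    by_contra h
    have := hτ (not_lt.1 h)
    have hinv : ∀ i, τ (τ⁻¹ i) = i := τ.apply_symm_apply
    simp only [hinv] at this
    exact absurd this (not_le.2 hij)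
  have hit : itinerary (fun j => g j 0) τ⁻¹ = g := by
    funext j k
    rw [itinerary]
    induction k generalizing j with
    | zero => rfl
    | succ k ih =>
      rw [pow_succ, Equiv.Perm.mul_apply, ih, h2]
  refine ⟨fun j => g j 0, τ⁻¹, ?_, by rw [hit, hgf]⟩
  intro i j hij
  rw [Prod.Lex.toLex_lt_toLex]
  have hle : twist (g i) ≤ twist (g j) := hmono hij.le
  rcases (head_le_of_twist_le hle).lt_or_eq with h | h
  · exact Or.inl h
  · refine Or.inr ⟨congrArg Fin.val h, ?_⟩
    simp only [← h]
    rcases altSign_eq_or (g i 0) with hs | hs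
    · have := h3 i j (by
        rw [sortKey, sortKey, Prod.Lex.toLex_lt_toLex, ← h]
        rcases (twist_tail_le_of_altSign_eq_one hle h hs).lt_or_eq with hlt | heq
        · exact Or.inl hlt
        · refine Or.inr ⟨heq, ?_⟩
          simp only [hs, one_mul]
          exact_mod_cast hij)
      rw [hs, one_mul, one_mul]
      exact_mod_cast this
    · have := h3 j i (by
        rw [sortKey, sortKey, Prod.Lex.toLex_lt_toLex, ← h]
        rcases (twist_tail_le_of_altSign_eq_neg_one hle h hs).lt_or_eq with hlt | heq
        · exact Or.inl hlt
        · refine Or.inr ⟨heq, ?_⟩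
          simp only [hs, neg_one_mul, neg_lt_neg_iff]
          exact_mod_cast hij)
      rw [hs, neg_one_mul, neg_one_mul, neg_lt_neg_iff]
      exact_mod_cast this

end Itinerary
end Words

/-! ### Orbits of a permutation and its cycle counts -/

section PermOrbits
open Equiv.Perm
variable {α : Type*} [Finite α] (σ : Equiv.Perm α)

/-- The set of orbits of a permutation. -/
abbrev PermOrbit : Type _ := Quotient (SameCycle.setoid σ)

omit [Finite α] in
theorem pow_apply_eq_self_iff (x : α) (k : ℕ) :
    (σ ^ k) x = x ↔ Function.minimalPeriod σ x ∣ k := by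
  rw [← Function.isPeriodicPt_iff_minimalPeriod_dvd, Function.IsPeriodicPt, Function.IsFixedPt,
    iterate_eq_pow]

theorem minimalPeriod_perm_pos (x : α) : 0 < Function.minimalPeriod σ x := by
  have h := (pow_apply_eq_self_iff σ x (orderOf σ)).1 (by rw [pow_orderOf_eq_one]; rfl)
  exact Nat.pos_of_dvd_of_pos h (orderOf_pos σ)

theorem minimalPeriod_apply_perm (x : α) :
    Function.minimalPeriod σ (σ x) = Function.minimalPeriod σ x :=
  Function.minimalPeriod_apply (Function.minimalPeriod_pos_iff_mem_periodicPts.1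
    (minimalPeriod_perm_pos σ x))

theorem apply_eq_of_sameCycle {β : Type*} {f : α → β} (hf : ∀ x, f (σ x) = f x) {x y : α}
    (h : SameCycle σ x y) : f x = f y := by
  obtain ⟨k, rfl⟩ := h.exists_nat_pow_eq
  induction k with
  | zero => rfl
  | succ k ih =>
    rw [pow_succ', Equiv.Perm.mul_apply, hf]
    exact ih ⟨k, by simp⟩

/-- The number of elements of an orbit. -/
noncomputable def orbitPeriod (O : PermOrbit σ) : ℕ := Function.minimalPeriod σ O.out

theorem orbitPeriod_pos (O : PermOrbit σ) : 0 < orbitPeriod σ O := minimalPeriod_perm_pos σ _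

theorem apply_out_eq {β : Type*} {f : α → β} (hf : ∀ x, f (σ x) = f x) (x : α) :
    f (Quotient.out (Quotient.mk (SameCycle.setoid σ) x)) = f x :=
  apply_eq_of_sameCycle σ hf (Quotient.mk_out (s := SameCycle.setoid σ) x)

open Classical in
theorem sum_eq_sum_orbitPeriod_mul [Fintype α] [Fintype (PermOrbit σ)] {f : α → ℕ}
    (hf : ∀ x, f (σ x) = f x) :
    ∑ x, f x = ∑ O : PermOrbit σ, orbitPeriod σ O * f O.out := by
  rw [← Finset.sum_fiberwise (s := Finset.univ) (g := fun x => Quotient.mk (SameCycle.setoid σ) x)]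
  refine Finset.sum_congr rfl fun O _ => ?_
  have h1 : ∀ x ∈ Finset.univ.filter (fun x => Quotient.mk (SameCycle.setoid σ) x = O),
      f x = f O.out := by
    intro x hx
    rw [← (Finset.mem_filter.1 hx).2, apply_out_eq σ hf]
  rw [Finset.sum_congr rfl h1, Finset.sum_const, smul_eq_mul]
  congr 1
  have h2 : Finset.univ.filter (fun x => Quotient.mk (SameCycle.setoid σ) x = O) =
      (Finset.range (orbitPeriod σ O)).image fun k => σ^[k] O.out := by
    ext x
    simp only [Finset.mem_filter, Finset.mem_univ, true_and, Finset.mem_image, Finset.mem_range]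
    constructor
    · intro hx
      have : SameCycle σ O.out x := by
        rw [← hx]
        exact Quotient.mk_out (s := SameCycle.setoid σ) x
      obtain ⟨k, hk⟩ := this.exists_nat_pow_eq
      refine ⟨k % orbitPeriod σ O, Nat.mod_lt _ (orbitPeriod_pos σ O), ?_⟩
      rw [orbitPeriod, Function.iterate_mod_minimalPeriod_eq, iterate_eq_pow, hk]
    · rintro ⟨k, -, rfl⟩
      conv_rhs => rw [← Quotient.out_eq O]
      refine Quotient.sound (s := SameCycle.setoid σ) (SameCycle.symm ⟨k, ?_⟩)
      rw [iterate_eq_pow, zpow_natCast]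
  rw [h2, Finset.card_image_of_injOn, Finset.card_range]
  intro i hi j hj hij
  simp only [Finset.coe_range] at hi hj
  exact Function.iterate_injOn_Iio_minimalPeriod hi hj hij

end PermOrbits

/-- Both sides count the points on `i`-cycles. Fixed points are treated apart because `cycleType`
omits them and `partition` adds them back; otherwise the points are grouped by their cycle factor.
-/
theorem mul_cycleCount {n : ℕ} (v : Equiv.Perm (Fin n)) {i : ℕ} (hi : 0 < i) :
    i * cycleCount i v = (Finset.univ.filter fun j => Function.minimalPeriod v j = i).card := by
  classical
  rw [cycleCount, Equiv.Perm.parts_partition, Multiset.count_add, Multiset.count_replicate]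
  have hone : ∀ j, Function.minimalPeriod v j = 1 ↔ j ∉ v.support := fun j => by
    rw [Function.minimalPeriod_eq_one_iff_isFixedPt, Equiv.Perm.notMem_support]
    rfl
  rcases eq_or_ne i 1 with rfl | hi1
  · rw [Multiset.count_eq_zero_of_notMem fun h =>
      absurd (Equiv.Perm.one_lt_of_mem_cycleType h) (lt_irrefl _), if_pos rfl]
    rw [Finset.filter_congr fun j _ => hone j, Finset.filter_not, Finset.card_sdiff,
      Finset.filter_mem_eq_inter, Finset.univ_inter, Finset.inter_univ, Finset.card_univ]
    simp
  · rw [if_neg hi1.symm, add_zero, Equiv.Perm.cycleType_def, Multiset.count_map]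
    have hper : ∀ j ∈ v.support, Function.minimalPeriod v j = (v.cycleOf j).support.card := by
      intro j hj
      have hc := Equiv.Perm.isCycle_cycleOf v (Equiv.Perm.mem_support.1 hj)
      rw [← hc.orderOf]
      refine Nat.dvd_antisymm ?_ ?_
      · rw [← pow_apply_eq_self_iff, ← Equiv.Perm.cycleOf_pow_apply_self, pow_orderOf_eq_one]
        rfl
      · rw [orderOf_dvd_iff_pow_eq_one, hc.pow_eq_one_iff' (x := j),
          Equiv.Perm.cycleOf_pow_apply_self, pow_apply_eq_self_iff]
        rw [Equiv.Perm.cycleOf_apply_self]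
        exact Equiv.Perm.mem_support.1 hj
    have hmaps : Set.MapsTo (fun j => v.cycleOf j)
        (Finset.univ.filter fun j => Function.minimalPeriod v j = i : Finset (Fin n))
        (v.cycleFactorsFinset.filter fun g => i = (Finset.card ∘ Equiv.Perm.support) g :
          Finset (Equiv.Perm (Fin n))) := by
      intro j hj
      have hj' := (Finset.mem_filter.1 hj).2
      have hs : j ∈ v.support := by
        by_contra h
        exact hi1 (hj'.symm.trans ((hone j).2 h))
      simp only [Finset.coe_filter, Set.mem_ofPred_eq, Equiv.Perm.cycleOf_mem_cycleFactorsFinset_iff]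
      exact ⟨hs, by rw [← hj', hper j hs]; rfl⟩
    rw [Finset.card_eq_sum_card_fiberwise hmaps, Finset.sum_congr rfl (g := fun _ => i),
      Finset.sum_const, smul_eq_mul, mul_comm]
    · rfl
    intro g hg
    obtain ⟨hg1, hg2⟩ := Finset.mem_filter.1 hg
    conv_rhs => rw [hg2]
    simp only [Function.comp]
    congr 1
    ext j
    have hsub : g.support ⊆ v.support := Equiv.Perm.mem_cycleFactorsFinset_support_le hg1
    simp only [Finset.mem_filter, Finset.mem_univ, true_and]
    rw [← Equiv.Perm.eq_cycleOf_of_mem_cycleFactorsFinset_iff v g hg1 j]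
    constructor
    · exact fun h => h.2.symm
    · intro h
      refine ⟨?_, h.symm⟩
      have : j ∈ v.support :=
        hsub ((Equiv.Perm.eq_cycleOf_of_mem_cycleFactorsFinset_iff v g hg1 j).1 h)
      rw [hper j this, ← h]
      exact hg2.symm

/-! ### Periodic words, the shift, and signs -/

section PeriodicWords
variable {c L : ℕ}

/-- The infinite words with letters in `Fin c` and period `L`. -/
abbrev PeriodicWord (c L : ℕ) : Type := {z : ℕ → Fin c // Function.Periodic z L}

theorem periodic_mod (i : ℕ) [NeZero i] (w : Fin i → Fin c) :
    Function.Periodic (fun k => w (Fin.ofNat i k)) i := by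
  intro k
  simp [Fin.ofNat]

/-- Words of period `i` are determined by their first `i` letters. -/
def periodicWordEquiv (c i : ℕ) [NeZero i] : PeriodicWord c i ≃ (Fin i → Fin c) where
  toFun z k := z.1 k
  invFun w := ⟨fun k => w (Fin.ofNat i k), periodic_mod i w⟩
  left_inv z := by
    refine Subtype.ext (funext fun k => ?_)
    simp only [Fin.ofNat]
    exact z.2.map_mod_nat k
  right_inv w := by
    funext k
    simp

noncomputable instance [NeZero L] : Fintype (PeriodicWord c L) :=
  Fintype.ofEquiv _ (periodicWordEquiv c L).symm

/-- The shift on words with period `L`, a permutation. -/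
def shiftPerm (c L : ℕ) [NeZero L] : Equiv.Perm (PeriodicWord c L) where
  toFun z := ⟨fun k => z.1 (k + 1), fun k =>
    (congrArg z.1 (by omega)).trans (z.2 (k + 1))⟩
  invFun z := ⟨fun k => z.1 (k + (L - 1)), fun k =>
    (congrArg z.1 (by omega)).trans (z.2 (k + (L - 1)))⟩
  left_inv z := by
    have := NeZero.pos L
    refine Subtype.ext (funext fun k => ?_)
    exact (congrArg z.1 (by omega)).trans (z.2 k)
  right_inv z := by
    have := NeZero.pos L
    refine Subtype.ext (funext fun k => ?_)
    exact (congrArg z.1 (by omega)).trans (z.2 k)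

variable [NeZero L]

theorem shiftPerm_apply (z : PeriodicWord c L) (k : ℕ) :
    (shiftPerm c L z).1 k = z.1 (k + 1) := rfl

theorem shiftPerm_pow_apply (z : PeriodicWord c L) (i k : ℕ) :
    ((shiftPerm c L ^ i) z).1 k = z.1 (k + i) := by
  induction i generalizing k with
  | zero => rfl
  | succ i ih =>
    rw [pow_succ', Equiv.Perm.mul_apply, shiftPerm_apply, ih]
    exact congrArg z.1 (by omega)

/-- The smallest period of a word. -/
noncomputable def wordPeriod (z : PeriodicWord c L) : ℕ := Function.minimalPeriod (shiftPerm c L) z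

theorem wordPeriod_pos (z : PeriodicWord c L) : 0 < wordPeriod z := minimalPeriod_perm_pos _ z

theorem wordPeriod_shift (z : PeriodicWord c L) : wordPeriod (shiftPerm c L z) = wordPeriod z :=
  minimalPeriod_apply_perm _ z

theorem periodic_iff_wordPeriod_dvd (z : PeriodicWord c L) (i : ℕ) :
    Function.Periodic z.1 i ↔ wordPeriod z ∣ i := by
  rw [wordPeriod, ← pow_apply_eq_self_iff, Subtype.ext_iff, funext_iff]
  exact forall_congr' fun k => by rw [shiftPerm_pow_apply]

theorem wordPeriod_dvd (z : PeriodicWord c L) : wordPeriod z ∣ L :=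
  (periodic_iff_wordPeriod_dvd z L).1 z.2

omit [NeZero L] in
theorem signProd_add (z : ℕ → Fin c) (a b : ℕ) :
    signProd z (a + b) = signProd z a * signProd (fun k => z (k + a)) b := by
  rw [signProd, Finset.prod_range_add]
  simp only [signProd, add_comm a]

omit [NeZero L] in
theorem signProd_mul_of_periodic {z : ℕ → Fin c} {a : ℕ} (h : Function.Periodic z a) (d : ℕ) :
    signProd z (a * d) = signProd z a ^ d := by
  induction d with
  | zero => simp [signProd_zero]
  | succ d ih =>
    rw [Nat.mul_succ, add_comm, signProd_add, pow_succ', ← ih]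
    congr 2
    funext k
    exact h k

/-- The sign of a periodic word: the product of the signs of the letters of one period. -/
noncomputable def wordSign (z : PeriodicWord c L) : ℤ := signProd z.1 (wordPeriod z)

theorem wordSign_eq_or (z : PeriodicWord c L) : wordSign z = 1 ∨ wordSign z = -1 :=
  signProd_eq_or _ _

/-- Take one letter more than a period. Its first and last letters coincide, so removing either one
leaves the same sign product. -/
theorem wordSign_shift (z : PeriodicWord c L) : wordSign (shiftPerm c L z) = wordSign z := by
  rw [wordSign, wordPeriod_shift, wordSign]
  have h1 : signProd z.1 (wordPeriod z + 1) =
      altSign (z.1 0) * signProd (shiftPerm c L z).1 (wordPeriod z) := signProd_succ' _ _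
  have h2 : signProd z.1 (wordPeriod z + 1) = signProd z.1 (wordPeriod z) * altSign (z.1 0) := by
    rw [signProd, Finset.prod_range_succ, ← signProd]
    congr 3
    have := (periodic_iff_wordPeriod_dvd z _).2 dvd_rfl 0
    rwa [zero_add] at this
  have h3 : altSign (z.1 0) ≠ 0 := by rcases altSign_eq_or (z.1 0) with h | h <;> simp [h]
  rw [h1, mul_comm] at h2
  exact mul_right_cancel₀ h3 h2

theorem signProd_of_wordPeriod_dvd (z : PeriodicWord c L) {i : ℕ} (h : wordPeriod z ∣ i) :
    signProd z.1 i = wordSign z ^ (i / wordPeriod z) := by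
  conv_lhs => rw [← Nat.mul_div_cancel' h]
  exact signProd_mul_of_periodic ((periodic_iff_wordPeriod_dvd z _).2 dvd_rfl) _

/-- Words with period `i` are arbitrary blocks of length `i`. Constant `F` yields the total count
and the identity yields the signed count. -/
theorem sum_filter_wordPeriod_dvd {i : ℕ} [NeZero i] (hi : i ∣ L) (F : ℤ → ℤ) :
    ∑ z : PeriodicWord c L with wordPeriod z ∣ i, F (signProd z.1 i) =
      ∑ w : Fin i → Fin c, F (∏ k, altSign (w k)) := by
  rw [← (periodicWordEquiv c i).sum_comp fun w => F (∏ k, altSign (w k))]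
  refine Finset.sum_bij' (fun z hz => ⟨z.1, (periodic_iff_wordPeriod_dvd z i).2
      (Finset.mem_filter.1 hz).2⟩)
    (fun y _ => ⟨y.1, by
      obtain ⟨d, rfl⟩ := hi
      have := y.2.nat_mul d
      rwa [mul_comm] at this⟩) ?_ ?_ ?_ ?_ ?_
  · intro z _
    exact Finset.mem_univ _
  · intro y _
    simp only [Finset.mem_filter, Finset.mem_univ, true_and]
    exact (periodic_iff_wordPeriod_dvd _ i).1 y.2
  · intro z _
    rfl
  · intro y _
    rfl
  · intro z _
    rw [signProd, Finset.prod_range]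
    rfl

end PeriodicWords

/-! ### Counting necklaces by period and sign -/

theorem two_mul_cycleExponent {i : ℕ} (hi : i ≠ 0) (m : ℕ) :
    2 * (i : ℤ) * cycleExponent i m = cycleSum i m := by
  have h1 : 2 * (i : ℤ) ∣ cycleSum i m := by exact_mod_cast two_mul_dvd_cycleSum m hi
  rw [cycleExponent, Int.toNat_of_nonneg (Int.ediv_nonneg (cycleSum_nonneg m hi) (by positivity)),
    Int.mul_ediv_cancel' h1]

/-- The restriction of an arithmetic function to the odd numbers. -/
def oddPart (f : ArithmeticFunction ℤ) : ArithmeticFunction ℤ :=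
  ⟨fun n => if Odd n then f n else 0, by simp⟩

theorem oddPart_apply (f : ArithmeticFunction ℤ) (n : ℕ) :
    oddPart f n = if Odd n then f n else 0 := rfl

/-- A product is odd exactly when both factors are, so restriction to odd numbers respects Dirichlet
convolution. -/
theorem oddPart_zeta_mul_oddPart_moebius :
    oddPart (ArithmeticFunction.zeta : ArithmeticFunction ℤ) *
      oddPart ArithmeticFunction.moebius = 1 := by
  ext n
  by_cases hn : Odd n
  · rw [← ArithmeticFunction.coe_zeta_mul_moebius, ArithmeticFunction.mul_apply,
      ArithmeticFunction.mul_apply]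
    refine Finset.sum_congr rfl fun x hx => ?_
    have h := Nat.odd_mul.1 ((Nat.mem_divisorsAntidiagonal.1 hx).1.symm ▸ hn)
    rw [oddPart_apply, oddPart_apply, if_pos h.1, if_pos h.2]
  · rw [ArithmeticFunction.mul_apply, ArithmeticFunction.one_apply_ne
      (by rintro rfl; exact hn odd_one)]
    refine Finset.sum_eq_zero fun x hx => ?_
    have h := (Nat.mem_divisorsAntidiagonal.1 hx).1
    by_cases h1 : Odd x.1
    · rw [oddPart_apply _ x.2, if_neg fun h2 => hn (h ▸ h1.mul h2), mul_zero]
    · rw [oddPart_apply _ x.1, if_neg h1, zero_mul]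

/-- `cycleSum` is the convolution of the odd part of the Möbius function with `(2m)^n`; convolving
with the odd part of zeta undoes it. -/
theorem sum_cycleSum {i : ℕ} (hi : i ≠ 0) (m : ℕ) :
    ∑ d ∈ i.divisors with Odd (i / d), cycleSum d m = (2 * (m : ℤ)) ^ i := by
  let g : ArithmeticFunction ℤ := ⟨fun n => if n = 0 then 0 else (2 * (m : ℤ)) ^ n, by simp⟩
  have hg : ∀ n, n ≠ 0 → g n = (2 * (m : ℤ)) ^ n := fun n hn => if_neg hn
  have h1 : ∀ d, d ≠ 0 → (oddPart ArithmeticFunction.moebius * g) d = cycleSum d m := by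
    intro d hd
    rw [ArithmeticFunction.mul_apply, Nat.sum_divisorsAntidiagonal
      (f := fun a b => oddPart ArithmeticFunction.moebius a * g b), cycleSum, Finset.sum_filter]
    refine Finset.sum_congr rfl fun e he => ?_
    have hde : d / e ≠ 0 := (Nat.div_pos (Nat.divisor_le he) (Nat.pos_of_mem_divisors he)).ne'
    rw [oddPart_apply, hg _ hde]
    split_ifs <;> simp
  have h2 : (oddPart (ArithmeticFunction.zeta : ArithmeticFunction ℤ) *
      (oddPart ArithmeticFunction.moebius * g)) i = g i := by
    rw [← mul_assoc, oddPart_zeta_mul_oddPart_moebius, one_mul]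
  rw [ArithmeticFunction.mul_apply, Nat.sum_divisorsAntidiagonal'
    (f := fun a b => oddPart (ArithmeticFunction.zeta : ArithmeticFunction ℤ) a *
      (oddPart ArithmeticFunction.moebius * g) b), hg i hi] at h2
  rw [← h2, Finset.sum_filter]
  refine Finset.sum_congr rfl fun d hd => ?_
  have hd0 := (Nat.pos_of_mem_divisors hd).ne'
  have hde : i / d ≠ 0 := (Nat.div_pos (Nat.divisor_le hd) (Nat.pos_of_mem_divisors hd)).ne'
  rw [h1 d hd0, oddPart_apply]
  split_ifs <;> simp [hde]

/-- The term `d = i` occurs because `P 1` holds, and strong induction cancels the rest. It serves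
for odd cofactors and for all cofactors. -/
theorem eq_of_sum_divisors_eq {L : ℕ} (P : ℕ → Prop) [DecidablePred P] (hP : P 1) {X Y : ℕ → ℤ}
    (h : ∀ i, i ≠ 0 → i ∣ L → ∑ d ∈ i.divisors with P (i / d), X d =
      ∑ d ∈ i.divisors with P (i / d), Y d) (i : ℕ) (hi : i ≠ 0) (hiL : i ∣ L) : X i = Y i := by
  induction i using Nat.strong_induction_on with
  | _ i ih =>
    have hmem : i ∈ i.divisors.filter fun d => P (i / d) := by
      simp [hi, Nat.div_self (Nat.pos_of_ne_zero hi), hP]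
    have h1 := h i hi hiL
    rw [← Finset.add_sum_erase _ _ hmem, ← Finset.add_sum_erase _ _ hmem] at h1
    rw [Finset.sum_congr rfl (g := Y)] at h1
    · exact add_right_cancel h1
    · intro d hd
      obtain ⟨hd1, hd2⟩ := Finset.mem_erase.1 hd
      have hd3 := (Finset.mem_filter.1 hd2).1
      exact ih d (lt_of_le_of_ne (Nat.divisor_le hd3) hd1) (Nat.pos_of_mem_divisors hd3).ne'
        ((Nat.dvd_of_mem_divisors hd3).trans hiL)

theorem sum_altSign_fin (m : ℕ) : ∑ a : Fin (2 * m), altSign a = 0 := by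
  rw [Fin.sum_univ_eq_sum_range altSign]
  induction m with
  | zero => simp
  | succ m ih =>
    rw [show 2 * (m + 1) = 2 * m + 1 + 1 by ring, Finset.sum_range_succ, Finset.sum_range_succ, ih,
      altSign_even, altSign_odd]
    norm_num

section
variable {m L : ℕ} [NeZero L]

/-- The number of words with a given smallest period and a given sign. -/
noncomputable def wordCount (m L : ℕ) [NeZero L] (s : ℤ) (d : ℕ) : ℕ :=
  (Finset.univ.filter fun z : PeriodicWord (2 * m) L => wordPeriod z = d ∧ wordSign z = s).card

theorem sum_wordPeriod_dvd_eq {i : ℕ} (hi : i ≠ 0) (G : ℕ → ℤ → ℤ) :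
    ∑ z : PeriodicWord (2 * m) L with wordPeriod z ∣ i, G (wordPeriod z) (wordSign z) =
      ∑ d ∈ i.divisors, (wordCount m L 1 d * G d 1 + wordCount m L (-1) d * G d (-1)) := by
  rw [← Finset.sum_fiberwise_of_maps_to (t := i.divisors) (g := fun z => wordPeriod z)
    (fun z hz => Nat.mem_divisors.2 ⟨(Finset.mem_filter.1 hz).2, hi⟩)]
  refine Finset.sum_congr rfl fun d hd => ?_
  rw [Finset.filter_filter, ← Finset.sum_filter_add_sum_filter_not _ fun z => wordSign z = 1,
    Finset.filter_filter, Finset.filter_filter]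
  have h1 : (Finset.univ.filter fun z : PeriodicWord (2 * m) L =>
      (wordPeriod z ∣ i ∧ wordPeriod z = d) ∧ wordSign z = 1) =
      Finset.univ.filter fun z => wordPeriod z = d ∧ wordSign z = 1 := by
    refine Finset.filter_congr fun z _ => ?_
    have := Nat.dvd_of_mem_divisors hd
    constructor
    · exact fun h => ⟨h.1.2, h.2⟩
    · exact fun h => ⟨⟨h.1.symm ▸ this, h.1⟩, h.2⟩
  have h2 : (Finset.univ.filter fun z : PeriodicWord (2 * m) L =>
      (wordPeriod z ∣ i ∧ wordPeriod z = d) ∧ ¬ wordSign z = 1) =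
      Finset.univ.filter fun z => wordPeriod z = d ∧ wordSign z = -1 := by
    refine Finset.filter_congr fun z _ => ?_
    have := Nat.dvd_of_mem_divisors hd
    have h3 : ¬ wordSign z = 1 ↔ wordSign z = -1 := by
      rcases wordSign_eq_or z with h | h <;> simp [h]
    rw [h3]
    constructor
    · exact fun h => ⟨h.1.2, h.2⟩
    · exact fun h => ⟨⟨h.1.symm ▸ this, h.1⟩, h.2⟩
  rw [h1, h2, wordCount, wordCount]
  congr 1
  all_goals
    rw [Finset.sum_congr rfl (g := fun _ => G d _)
      (fun z hz => by rw [(Finset.mem_filter.1 hz).2.1, (Finset.mem_filter.1 hz).2.2]),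
      Finset.sum_const, nsmul_eq_mul]

theorem sum_wordCount {i : ℕ} (hi : i ≠ 0) (hiL : i ∣ L) :
    ∑ d ∈ i.divisors, ((wordCount m L 1 d : ℤ) + wordCount m L (-1) d) = (2 * (m : ℤ)) ^ i := by
  have : NeZero i := ⟨hi⟩
  have h := sum_wordPeriod_dvd_eq (m := m) (L := L) hi fun _ _ => 1
  rw [sum_filter_wordPeriod_dvd hiL fun _ => 1] at h
  simpa using h.symm

/-- The sum of the sign products of all blocks of length `i` factors as the `i`-th power of the sum
of the letter signs, which is zero for an alphabet of even size. A word of period `d` and sign `s`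
contributes `s^(i/d)`. -/
theorem sum_signed_wordCount {i : ℕ} (hi : i ≠ 0) (hiL : i ∣ L) :
    ∑ d ∈ i.divisors, ((wordCount m L 1 d : ℤ) + wordCount m L (-1) d * (-1) ^ (i / d)) = 0 := by
  have : NeZero i := ⟨hi⟩
  have h := sum_wordPeriod_dvd_eq (m := m) (L := L) hi fun d s => s ^ (i / d)
  rw [Finset.sum_congr rfl (g := fun z => signProd z.1 i)
    (fun z hz => (signProd_of_wordPeriod_dvd z (Finset.mem_filter.1 hz).2).symm),
    sum_filter_wordPeriod_dvd hiL fun s => s] at h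
  have h0 : ∑ w : Fin i → Fin (2 * m), ∏ k, altSign (w k) = 0 := by
    rw [← Fintype.prod_sum (f := fun (_ : Fin i) (a : Fin (2 * m)) => altSign a)]
    simp only [sum_altSign_fin, Finset.prod_const, Finset.card_univ, Fintype.card_fin]
    exact zero_pow hi
  rw [h0] at h
  simpa using h.symm

/-- Subtracting the signed from the total count leaves twice the negative words with odd `i / d`. By
`sum_cycleSum` the numbers `d * f_{d,m}` satisfy the same relations. -/
theorem wordCount_neg {d : ℕ} (hd : d ≠ 0) (hdL : d ∣ L) :
    (wordCount m L (-1) d : ℤ) = d * cycleExponent d m := by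
  refine eq_of_sum_divisors_eq (L := L) Odd odd_one (X := fun d => (wordCount m L (-1) d : ℤ))
    (Y := fun d => (d : ℤ) * cycleExponent d m) ?_ d hd hdL
  intro i hi hiL
  have h1 := sum_wordCount (m := m) hi hiL
  have h2 := sum_signed_wordCount (m := m) hi hiL
  have h3 := sum_cycleSum hi m
  have h4 : ∑ d ∈ i.divisors with Odd (i / d), 2 * (wordCount m L (-1) d : ℤ) =
      (2 * (m : ℤ)) ^ i := by
    rw [← h1, ← sub_zero (∑ d ∈ i.divisors, _), ← h2, ← Finset.sum_sub_distrib, Finset.sum_filter]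
    refine Finset.sum_congr rfl fun d _ => ?_
    split_ifs with ho
    · rw [ho.neg_one_pow]; ring
    · rw [(Nat.not_odd_iff_even.1 ho).neg_one_pow]; ring
  have h5 : ∑ d ∈ i.divisors with Odd (i / d), 2 * ((d : ℤ) * cycleExponent d m) =
      (2 * (m : ℤ)) ^ i := by
    rw [← h3]
    refine Finset.sum_congr rfl fun d hd => ?_
    rw [← two_mul_cycleExponent (Nat.pos_of_mem_divisors (Finset.mem_filter.1 hd).1).ne']
    ring
  rw [← Finset.mul_sum] at h4 h5
  exact mul_left_cancel₀ two_ne_zero (h4.trans h5.symm)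

/-- The signed count expresses the positive words through the negative ones. The claim then reduces
to matching the divisors with `i / d` even against the even divisors, by doubling. -/
theorem wordCount_pos {d : ℕ} (hd : d ≠ 0) (hdL : d ∣ L) :
    (wordCount m L 1 d : ℤ) = d * cycleExponent d m -
      if Even d then (d : ℤ) * cycleExponent (d / 2) m else 0 := by
  refine eq_of_sum_divisors_eq (L := L) (fun _ => True) trivial
    (X := fun d => (wordCount m L 1 d : ℤ))
    (Y := fun d => (d : ℤ) * cycleExponent d m -
      if Even d then (d : ℤ) * cycleExponent (d / 2) m else 0) ?_ d hd hdL
  intro i hi hiL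
  simp only [Finset.filter_true]
  have h2 := sum_signed_wordCount (m := m) hi hiL
  rw [Finset.sum_add_distrib, Finset.sum_congr rfl (g := fun d => (d : ℤ) * cycleExponent d m *
    (-1) ^ (i / d)) (s₁ := i.divisors) (s₂ := i.divisors) (f := fun d => (wordCount m L (-1) d : ℤ) *
    (-1) ^ (i / d)) (fun d hd => by
      rw [wordCount_neg (Nat.pos_of_mem_divisors hd).ne'
        ((Nat.dvd_of_mem_divisors hd).trans hiL)])] at h2
  rw [eq_neg_of_add_eq_zero_left h2, Finset.sum_sub_distrib, ← Finset.sum_filter, eq_sub_iff_add_eq,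
    ← eq_sub_iff_add_eq']
  rw [sub_neg_eq_add, ← Finset.sum_add_distrib]
  have h3 : ∑ d ∈ i.divisors, ((d : ℤ) * cycleExponent d m +
      (d : ℤ) * cycleExponent d m * (-1) ^ (i / d)) =
      ∑ d ∈ i.divisors with Even (i / d), 2 * ((d : ℤ) * cycleExponent d m) := by
    rw [Finset.sum_filter]
    refine Finset.sum_congr rfl fun d _ => ?_
    split_ifs with he
    · rw [he.neg_one_pow]; ring
    · rw [(Nat.not_even_iff_odd.1 he).neg_one_pow]; ring
  rw [h3]
  refine Finset.sum_nbij' (fun d => d / 2) (fun d => 2 * d) ?_ ?_ ?_ ?_ ?_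
  · intro d hd
    simp only [Finset.mem_filter, Nat.mem_divisors] at hd ⊢
    obtain ⟨⟨⟨e, rfl⟩, -⟩, he⟩ := hd
    obtain ⟨f, rfl⟩ := even_iff_two_dvd.1 he
    have hf : 0 < f := Nat.pos_of_ne_zero fun h => hi (by simp [h])
    rw [Nat.mul_div_cancel_left _ two_pos]
    refine ⟨⟨⟨2 * e, by ring⟩, hi⟩, ?_⟩
    rw [show 2 * f * e = f * (2 * e) by ring, Nat.mul_div_cancel_left _ hf]
    exact even_two_mul e
  · intro d hd
    simp only [Finset.mem_filter, Nat.mem_divisors] at hd ⊢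
    obtain ⟨⟨⟨e, rfl⟩, -⟩, he⟩ := hd
    have hd0 : 0 < d := Nat.pos_of_ne_zero fun h => hi (by simp [h])
    rw [Nat.mul_div_cancel_left _ hd0] at he
    obtain ⟨f, rfl⟩ := even_iff_two_dvd.1 he
    exact ⟨⟨⟨f, by ring⟩, hi⟩, even_two_mul d⟩
  · intro d hd
    exact Nat.mul_div_cancel' (even_iff_two_dvd.1 (Finset.mem_filter.1 hd).2)
  · intro d _
    exact Nat.mul_div_cancel_left _ two_pos
  · intro d hd
    obtain ⟨f, rfl⟩ := even_iff_two_dvd.1 (Finset.mem_filter.1 hd).2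
    rw [Nat.mul_div_cancel_left _ two_pos]
    push_cast
    ring

/-- The orbits of the shift on words of period `L`. -/
abbrev Necklace (m L : ℕ) [NeZero L] : Type := PermOrbit (shiftPerm (2 * m) L)

noncomputable instance : Fintype (Necklace m L) := Fintype.ofFinite _

/-- The number of necklaces with a given period and a given sign. -/
noncomputable def necklaceCount (m L : ℕ) [NeZero L] (s : ℤ) (d : ℕ) : ℕ :=
  (Finset.univ.filter fun O : Necklace m L =>
    wordPeriod (O.out : PeriodicWord (2 * m) L) = d ∧
      wordSign (O.out : PeriodicWord (2 * m) L) = s).card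

theorem mul_necklaceCount (s : ℤ) (d : ℕ) : d * necklaceCount m L s d = wordCount m L s d := by
  rw [wordCount, Finset.card_filter, sum_eq_sum_orbitPeriod_mul (shiftPerm (2 * m) L)
    (fun z => by rw [wordPeriod_shift, wordSign_shift]), necklaceCount, Finset.card_filter,
    Finset.mul_sum]
  refine Finset.sum_congr rfl fun O _ => ?_
  split_ifs with h
  · rw [← h.1]; rfl
  · simp

theorem necklaceCount_neg {d : ℕ} (hd : d ≠ 0) (hdL : d ∣ L) :
    necklaceCount m L (-1) d = cycleExponent d m := by
  have h := wordCount_neg (m := m) hd hdL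
  rw [← mul_necklaceCount] at h
  exact Nat.eq_of_mul_eq_mul_left (Nat.pos_of_ne_zero hd) (by exact_mod_cast h)

theorem necklaceCount_pos {d : ℕ} (hd : d ≠ 0) (hdL : d ∣ L) :
    necklaceCount m L 1 d + (if Even d then cycleExponent (d / 2) m else 0) =
      cycleExponent d m := by
  have h := wordCount_pos (m := m) hd hdL
  rw [← mul_necklaceCount] at h
  refine Nat.eq_of_mul_eq_mul_left (Nat.pos_of_ne_zero hd) ?_
  zify
  push_cast at h
  split_ifs at h ⊢ <;> linarith

end

/-! ### The cycles that arise from a necklace -/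

/-- The number of `i`-cycles that come from `k` copies of each word of a necklace with sign `s` and
period `p`: cycles of length `p` for positive necklaces; for negative necklaces, the copies are
paired into cycles of length `2p`, and at most one copy is left over. -/
def necklaceCycles (s : ℤ) (p i k : ℕ) : ℕ :=
  if s = 1 then if p = i then k else 0
  else (if p = i then k % 2 else 0) + if 2 * p = i then k / 2 else 0

section
variable {c n L : ℕ} [NeZero L] {b : Fin n → Fin c} {v : Equiv.Perm (Fin n)}

/-- The itinerary as a periodic word. -/
def periodicItinerary (hL : n.factorial ∣ L) (b : Fin n → Fin c) (v : Equiv.Perm (Fin n))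
    (j : Fin n) : PeriodicWord c L :=
  ⟨itinerary b v j, itinerary_periodic hL j⟩

variable (hL : n.factorial ∣ L)

theorem periodicItinerary_apply (j : Fin n) :
    periodicItinerary hL b v (v j) = shiftPerm c L (periodicItinerary hL b v j) :=
  Subtype.ext (itinerary_apply b v j)

theorem periodicItinerary_pow_apply (k : ℕ) (j : Fin n) :
    periodicItinerary hL b v ((v ^ k) j) = (shiftPerm c L ^ k) (periodicItinerary hL b v j) := by
  induction k with
  | zero => rfl
  | succ k ih =>
    rw [pow_succ', Equiv.Perm.mul_apply, periodicItinerary_apply, ih, pow_succ',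
      Equiv.Perm.mul_apply]

theorem periodicItinerary_pow_eq_iff (k : ℕ) (j : Fin n) :
    periodicItinerary hL b v ((v ^ k) j) = periodicItinerary hL b v j ↔
      wordPeriod (periodicItinerary hL b v j) ∣ k := by
  rw [periodicItinerary_pow_apply, pow_apply_eq_self_iff, wordPeriod]

theorem wordPeriod_dvd_minimalPeriod (j : Fin n) :
    wordPeriod (periodicItinerary hL b v j) ∣ Function.minimalPeriod v j := by
  rw [← periodicItinerary_pow_eq_iff, (pow_apply_eq_self_iff v j _).2 dvd_rfl]

omit [NeZero L] in
theorem CompatiblePair.lt_iff_pow (h : CompatiblePair b v) {i j : Fin n}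
    (hij : itinerary b v i = itinerary b v j) (k : ℕ) :
    i < j ↔ signProd (itinerary b v i) k * (((v ^ k) i : ℕ) : ℤ) <
      signProd (itinerary b v i) k * (((v ^ k) j : ℕ) : ℤ) := by
  induction k with
  | zero => simp [signProd_zero]
  | succ k ih =>
    have hb : b ((v ^ k) i) = b ((v ^ k) j) := congrFun hij k
    have h1 := h.lt_iff hb
    have h2 := h.lt_iff hb.symm
    rw [← hb] at h2
    have e : signProd (itinerary b v i) (k + 1) =
        signProd (itinerary b v i) k * altSign (b ((v ^ k) i)) := Finset.prod_range_succ _ _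
    rw [ih, e, pow_succ', Equiv.Perm.mul_apply, Equiv.Perm.mul_apply]
    rcases signProd_eq_or (itinerary b v i) k with hs | hs
    · rw [hs, one_mul, one_mul, one_mul, ← h1]
      norm_cast
    · simp only [hs, neg_mul, one_mul, neg_lt_neg_iff]
      rw [← h2]
      norm_cast

/-- On the positions with a fixed itinerary, `v ^ k` preserves the order. If it moved `j`, the
iterates of `j` would form a strictly monotone infinite sequence in `Fin n`. -/
theorem CompatiblePair.pow_apply_eq_self (h : CompatiblePair b v) {j : Fin n} {k : ℕ}
    (hk : periodicItinerary hL b v ((v ^ k) j) = periodicItinerary hL b v j)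
    (hs : signProd (itinerary b v j) k = 1) : (v ^ k) j = j := by
  have hit : ∀ l, itinerary b v (((v ^ k) ^ l) j) = itinerary b v j := by
    intro l
    rw [← pow_mul]
    have := (periodicItinerary_pow_eq_iff (b := b) (v := v) hL (k * l) j).2
      (((periodicItinerary_pow_eq_iff hL k j).1 hk).mul_right l)
    exact congrArg Subtype.val this
  have hlt : ∀ i i', itinerary b v i = itinerary b v j → itinerary b v i' = itinerary b v j →
      i < i' → (v ^ k) i < (v ^ k) i' := by
    intro i i' hi hi' hii
    have := (h.lt_iff_pow (hi.trans hi'.symm) k).1 hii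
    rw [hi, hs, one_mul, one_mul] at this
    exact_mod_cast this
  rcases lt_trichotomy ((v ^ k) j) j with hlt1 | heq | hgt
  · have : StrictAnti fun l : ℕ => ((v ^ k) ^ l) j := by
      refine strictAnti_nat_of_succ_lt fun l => ?_
      induction l with
      | zero => simpa using hlt1
      | succ l ih =>
        rw [pow_succ' _ (l + 1), Equiv.Perm.mul_apply]
        conv_rhs => rw [pow_succ' _ l, Equiv.Perm.mul_apply]
        exact hlt _ _ (hit _) (hit _) ih
    exact absurd this.injective (not_injective_infinite_finite _)
  · exact heq
  · have : StrictMono fun l : ℕ => ((v ^ k) ^ l) j := by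
      refine strictMono_nat_of_lt_succ fun l => ?_
      induction l with
      | zero => simpa using hgt
      | succ l ih =>
        rw [pow_succ' _ (l + 1), Equiv.Perm.mul_apply]
        conv_lhs => rw [pow_succ' _ l, Equiv.Perm.mul_apply]
        exact hlt _ _ (hit _) (hit _) ih
    exact absurd this.injective (not_injective_infinite_finite _)

theorem CompatiblePair.minimalPeriod_of_pos (h : CompatiblePair b v) {j : Fin n}
    (hs : wordSign (periodicItinerary hL b v j) = 1) :
    Function.minimalPeriod v j = wordPeriod (periodicItinerary hL b v j) := by
  refine Nat.dvd_antisymm ?_ (wordPeriod_dvd_minimalPeriod hL j)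
  rw [← pow_apply_eq_self_iff]
  exact h.pow_apply_eq_self hL ((periodicItinerary_pow_eq_iff hL _ j).2 dvd_rfl) hs

theorem CompatiblePair.pow_two_mul_apply (h : CompatiblePair b v) (j : Fin n) :
    (v ^ (2 * wordPeriod (periodicItinerary hL b v j))) j = j := by
  refine h.pow_apply_eq_self hL
    ((periodicItinerary_pow_eq_iff hL _ j).2 (dvd_mul_left _ 2)) ?_
  -- The sign of two turns is a square, hence positive.
  have h1 := signProd_of_wordPeriod_dvd (periodicItinerary hL b v j) (dvd_mul_left _ 2)
  rw [Nat.mul_div_cancel _ (wordPeriod_pos _)] at h1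
  refine h1.trans ?_
  rcases wordSign_eq_or (periodicItinerary hL b v j) with h2 | h2 <;> simp [h2]

theorem CompatiblePair.minimalPeriod_eq_ite (h : CompatiblePair b v) (j : Fin n) :
    Function.minimalPeriod v j =
      if (v ^ wordPeriod (periodicItinerary hL b v j)) j = j
      then wordPeriod (periodicItinerary hL b v j)
      else 2 * wordPeriod (periodicItinerary hL b v j) := by
  have hd := wordPeriod_dvd_minimalPeriod (b := b) (v := v) hL j
  have h2 := (pow_apply_eq_self_iff v j _).1 (h.pow_two_mul_apply hL j)
  split_ifs with h1
  · exact Nat.dvd_antisymm ((pow_apply_eq_self_iff v j _).1 h1) hd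
  · rw [pow_apply_eq_self_iff] at h1
    obtain ⟨a, ha⟩ := hd
    rw [ha] at h1 h2 ⊢
    rw [mul_comm 2] at h2 ⊢
    have h3 : a ∣ 2 := Nat.dvd_of_mul_dvd_mul_left (wordPeriod_pos _) h2
    rcases (Nat.dvd_prime Nat.prime_two).1 h3 with rfl | rfl
    · simp at h1
    · rfl

open Classical in
/-- The positions with a given itinerary. -/
noncomputable def fiber (hL : n.factorial ∣ L) (b : Fin n → Fin c) (v : Equiv.Perm (Fin n))
    (z : PeriodicWord c L) : Finset (Fin n) :=
  Finset.univ.filter fun j => periodicItinerary hL b v j = z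

omit [NeZero L] in
theorem mem_fiber {z : PeriodicWord c L} {j : Fin n} :
    j ∈ fiber hL b v z ↔ periodicItinerary hL b v j = z := by simp [fiber]

theorem card_fiber_shift (z : PeriodicWord c L) :
    (fiber hL b v (shiftPerm c L z)).card = (fiber hL b v z).card := by
  symm
  refine Finset.card_nbij' v v.symm ?_ ?_ ?_ ?_
  · intro j hj
    rw [Finset.mem_coe, mem_fiber] at hj ⊢
    rw [periodicItinerary_apply, hj]
  · intro j hj
    rw [Finset.mem_coe, mem_fiber] at hj ⊢
    rw [← (shiftPerm c L).injective.eq_iff, ← hj, ← periodicItinerary_apply, v.apply_symm_apply]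
  · intro j _
    exact v.symm_apply_apply j
  · intro j _
    exact v.apply_symm_apply j

/-- One turn around a negative word reverses the order of the fibre, so it fixes at most one
position. Two turns are the identity, so it is an involution there and the other positions come in
pairs. -/
theorem CompatiblePair.card_fixed_fiber (h : CompatiblePair b v) {z : PeriodicWord c L}
    (hs : wordSign z = -1) :
    ((fiber hL b v z).filter fun j => (v ^ wordPeriod z) j = j).card =
      (fiber hL b v z).card % 2 := by
  set p := wordPeriod z
  have hone : ((fiber hL b v z).filter fun j => (v ^ p) j = j).card ≤ 1 := by
    rw [Finset.card_le_one]
    have key : ∀ i j, i ∈ (fiber hL b v z).filter (fun j => (v ^ p) j = j) →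
        j ∈ (fiber hL b v z).filter (fun j => (v ^ p) j = j) → ¬ i < j := by
      intro i j hi hj hij
      rw [Finset.mem_filter, mem_fiber] at hi hj
      have h1 : itinerary b v i = itinerary b v j :=
        congrArg Subtype.val (hi.1.trans hj.1.symm)
      have h2 := (h.lt_iff_pow h1 p).1 hij
      have h3 : signProd (itinerary b v i) p = -1 := by
        rw [← hs, wordSign, show itinerary b v i = z.1 from congrArg Subtype.val hi.1]
      rw [h3, hi.2, hj.2, neg_one_mul, neg_one_mul, neg_lt_neg_iff] at h2
      exact lt_asymm hij (by exact_mod_cast h2)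
    intro i hi j hj
    exact le_antisymm (not_lt.1 (key j i hj hi)) (not_lt.1 (key i j hi hj))
  have heven : (((fiber hL b v z).filter fun j => ¬ (v ^ p) j = j).card : ZMod 2) = 0 := by
    rw [Finset.card_eq_sum_ones, Nat.cast_sum]
    refine Finset.sum_involution (fun j _ => (v ^ p) j) ?_ ?_ ?_ ?_
    · intro _ _
      rfl
    · intro j hj _
      exact (Finset.mem_filter.1 hj).2
    · intro j hj
      rw [Finset.mem_filter, mem_fiber] at hj ⊢
      refine ⟨?_, fun h' => hj.2 ((v ^ p).injective h')⟩
      have := (periodicItinerary_pow_eq_iff (b := b) (v := v) hL p j).2 (by rw [hj.1])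
      rw [this, hj.1]
    · intro j hj
      rw [Finset.mem_filter, mem_fiber] at hj
      have := h.pow_two_mul_apply hL j
      rw [hj.1, two_mul, pow_add, Equiv.Perm.mul_apply] at this
      exact this
  have hsum := Finset.card_filter_add_card_filter_not (s := fiber hL b v z) fun j => (v ^ p) j = j
  rw [ZMod.natCast_eq_zero_iff] at heven
  omega

/-- The fibres of all shifts of `z` are equally populated, so the left side counts the points on
`i`-cycles over the whole necklace. Multiplying by the period avoids division. -/
theorem CompatiblePair.card_fiber_minimalPeriod (h : CompatiblePair b v) (z : PeriodicWord c L)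
    (i : ℕ) :
    wordPeriod z * ((fiber hL b v z).filter fun j => Function.minimalPeriod v j = i).card =
      i * necklaceCycles (wordSign z) (wordPeriod z) i (fiber hL b v z).card := by
  rcases wordSign_eq_or z with hs | hs
  · rw [necklaceCycles, if_pos hs, Finset.filter_congr (q := fun _ => wordPeriod z = i)]
    · split_ifs with hi
      · rw [Finset.filter_true_of_mem fun _ _ => hi, hi]
      · rw [Finset.filter_false_of_mem fun _ _ => hi]
        simp
    · intro j hj
      rw [mem_fiber] at hj
      rw [h.minimalPeriod_of_pos hL (by rw [hj, hs]), hj]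
  · have h1 := h.card_fixed_fiber hL hs
    have hsum := Finset.card_filter_add_card_filter_not (s := fiber hL b v z)
      fun j => (v ^ wordPeriod z) j = j
    have hper : ∀ j ∈ fiber hL b v z, Function.minimalPeriod v j =
        if (v ^ wordPeriod z) j = j then wordPeriod z else 2 * wordPeriod z := by
      intro j hj
      rw [mem_fiber] at hj
      rw [h.minimalPeriod_eq_ite hL, hj]
    have hp := wordPeriod_pos z
    rw [necklaceCycles, if_neg (by rw [hs]; norm_num)]
    by_cases hi : wordPeriod z = i
    · rw [if_pos hi, if_neg (by omega), add_zero, hi, ← h1]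
      congr 2
      refine Finset.filter_congr fun j hj => ?_
      rw [hper j hj]
      rw [← hi]
      split_ifs with h2
      · simp [h2]
      · simp only [h2, iff_false]
        omega
    · rw [if_neg hi, zero_add]
      by_cases hi2 : 2 * wordPeriod z = i
      · rw [if_pos hi2, Finset.filter_congr (q := fun j => ¬ (v ^ wordPeriod z) j = j)]
        · have h3 : ((fiber hL b v z).filter fun j => ¬ (v ^ wordPeriod z) j = j).card =
              2 * ((fiber hL b v z).card / 2) := by omega
          rw [h3, ← hi2]
          ring
        · intro j hj
          rw [hper j hj]
          split_ifs with h2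
          · simp [h2, hi]
          · simp [h2, hi2]
      · rw [if_neg hi2, Finset.filter_false_of_mem]
        · simp
        · intro j hj
          rw [hper j hj]
          split_ifs
          · exact hi
          · exact hi2

end

section
variable {m n L : ℕ} [NeZero L] {b : Fin n → Fin (2 * m)} {v : Equiv.Perm (Fin n)}

/-- After multiplication by `i`, count the points on `i`-cycles by itinerary, then collect the
itineraries into necklaces. -/
theorem CompatiblePair.cycleCount_eq (h : CompatiblePair b v) (hL : n.factorial ∣ L) {i : ℕ}
    (hi : 0 < i) :
    cycleCount i v = ∑ O : Necklace m L, necklaceCycles (wordSign O.out) (wordPeriod O.out) i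
      (fiber hL b v O.out).card := by
  classical
  refine Nat.eq_of_mul_eq_mul_left hi ?_
  rw [mul_cycleCount v hi, Finset.mul_sum]
  have h1 : (Finset.univ.filter fun j => Function.minimalPeriod v j = i).card =
      ∑ z : PeriodicWord (2 * m) L,
        ((fiber hL b v z).filter fun j => Function.minimalPeriod v j = i).card := by
    rw [Finset.card_eq_sum_card_fiberwise (f := periodicItinerary hL b v) (t := Finset.univ)
      (fun _ _ => Finset.mem_coe.2 (Finset.mem_univ _))]
    refine Finset.sum_congr rfl fun z _ => ?_
    rw [fiber, Finset.filter_filter, Finset.filter_filter]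
    congr 1
    ext j
    simp [and_comm]
  have hshift : ∀ z : PeriodicWord (2 * m) L,
      ((fiber hL b v (shiftPerm _ _ z)).filter fun j => Function.minimalPeriod v j = i).card =
      ((fiber hL b v z).filter fun j => Function.minimalPeriod v j = i).card := by
    intro z
    refine Nat.eq_of_mul_eq_mul_left (wordPeriod_pos z) ?_
    rw [h.card_fiber_minimalPeriod hL z i, ← wordPeriod_shift, h.card_fiber_minimalPeriod,
      wordSign_shift, card_fiber_shift]
  rw [h1, sum_eq_sum_orbitPeriod_mul (shiftPerm (2 * m) L) hshift]
  exact Finset.sum_congr rfl fun O _ => h.card_fiber_minimalPeriod hL _ i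

theorem sum_wordPeriod_mul_card_fiber (hL : n.factorial ∣ L) (b : Fin n → Fin (2 * m))
    (v : Equiv.Perm (Fin n)) :
    ∑ O : Necklace m L, wordPeriod (O.out : PeriodicWord (2 * m) L) * (fiber hL b v O.out).card = n := by
  classical
  refine (sum_eq_sum_orbitPeriod_mul (shiftPerm (2 * m) L)
    (f := fun z => (fiber hL b v z).card) (card_fiber_shift hL)).symm.trans ?_
  have := Finset.card_eq_sum_card_fiberwise (f := periodicItinerary hL b v) (s := Finset.univ)
    (t := Finset.univ) (fun _ _ => Finset.mem_coe.2 (Finset.mem_univ _))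
  rw [Finset.card_univ, Fintype.card_fin] at this
  conv_rhs => rw [this]
  refine Finset.sum_congr rfl fun z _ => ?_
  rw [fiber]

end

/-! ### Compatible pairs as families of necklace multiplicities -/

theorem exists_map_univ_eq {α : Type*} {n : ℕ} (M : Multiset α) (h : M.card = n) :
    ∃ f : Fin n → α, Finset.univ.val.map f = M := by
  subst h
  induction M using Quotient.inductionOn with
  | _ l =>
    refine ⟨fun j => l.get j, ?_⟩
    rw [Fin.univ_val_map]
    exact congrArg _ (List.ofFn_get l)

section
variable {m n L : ℕ} [NeZero L]

omit [NeZero L] in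
open Classical in
theorem count_map_periodicItinerary (hL : n.factorial ∣ L) (b : Fin n → Fin (2 * m))
    (v : Equiv.Perm (Fin n)) (z : PeriodicWord (2 * m) L) :
    (Finset.univ.val.map (periodicItinerary hL b v)).count z = (fiber hL b v z).card := by
  rw [Multiset.count_map, fiber]
  simp only [eq_comm (a := z)]
  rfl

/-- Fibre sizes are constant along a necklace, so their values at representatives determine the
multiset of itineraries. -/
theorem CompatiblePair.eq_of_card_fiber_eq {b b' : Fin n → Fin (2 * m)} {v v' : Equiv.Perm (Fin n)}
    (h : CompatiblePair b v) (h' : CompatiblePair b' v') (hL : n.factorial ∣ L)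
    (hc : ∀ O : Necklace m L, (fiber hL b v O.out).card = (fiber hL b' v' O.out).card) :
    b = b' ∧ v = v' := by
  classical
  refine h.eq_of_map_itinerary_eq h' ?_
  have h1 : Finset.univ.val.map (periodicItinerary hL b v) =
      Finset.univ.val.map (periodicItinerary hL b' v') := by
    ext z
    rw [count_map_periodicItinerary, count_map_periodicItinerary]
    have h2 := hc (Quotient.mk _ z)
    rwa [apply_out_eq (shiftPerm (2 * m) L) (f := fun z => (fiber hL b v z).card)
      (card_fiber_shift hL), apply_out_eq (shiftPerm (2 * m) L)
      (f := fun z => (fiber hL b' v' z).card) (card_fiber_shift hL)] at h2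
  have h2 := congrArg (Multiset.map Subtype.val) h1
  rwa [Multiset.map_map, Multiset.map_map] at h2

theorem exists_compatiblePair_of_multiplicity (hL : n.factorial ∣ L) (κ : Necklace m L → ℕ)
    (hκ : ∑ O, wordPeriod (O.out : PeriodicWord (2 * m) L) * κ O = n) :
    ∃ (b : Fin n → Fin (2 * m)) (v : Equiv.Perm (Fin n)), CompatiblePair b v ∧
      ∀ O : Necklace m L, (fiber hL b v O.out).card = κ O := by
  classical
  set σ := shiftPerm (2 * m) L
  set k : PeriodicWord (2 * m) L → ℕ := fun z => κ (Quotient.mk _ z) with hk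
  have hkσ : ∀ z, k (σ z) = k z := fun z =>
    congrArg κ (Quotient.sound (s := Equiv.Perm.SameCycle.setoid σ)
      (Equiv.Perm.sameCycle_apply_left.2 (Equiv.Perm.SameCycle.refl σ z)))
  -- Multiplicities that are constant on necklaces make `M` shift-invariant, so
  -- `exists_compatiblePair` applies.
  set M : Multiset (PeriodicWord (2 * m) L) := ∑ z, Multiset.replicate (k z) z with hM
  have hcount : ∀ z, M.count z = k z := by
    intro z
    rw [hM, Multiset.count_sum']
    simp [Multiset.count_replicate]
  have hcard : M.card = n := by
    rw [hM, Multiset.card_sum]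
    simp only [Multiset.card_replicate]
    rw [sum_eq_sum_orbitPeriod_mul σ hkσ, ← hκ]
    refine Finset.sum_congr rfl fun O _ => ?_
    rw [hk]
    simp only [Quotient.out_eq]
    rfl
  have hMσ : M.map σ = M := by
    ext z
    obtain ⟨z, rfl⟩ := σ.surjective z
    rw [Multiset.count_map_eq_count' _ _ σ.injective, hcount, hcount, hkσ]
  obtain ⟨f, hf⟩ := exists_map_univ_eq M hcard
  obtain ⟨b, v, hbv, hmap⟩ := exists_compatiblePair (fun j => (f j).1) (by
    have h1 := congrArg (Multiset.map Subtype.val) hMσ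
    rw [← hf, Multiset.map_map, Multiset.map_map, Multiset.map_map] at h1
    exact h1)
  refine ⟨b, v, hbv, fun O => ?_⟩
  have h2 : Finset.univ.val.map (periodicItinerary hL b v) = M := by
    apply Multiset.map_injective Subtype.val_injective
    rw [← hf, Multiset.map_map, Multiset.map_map]
    exact hmap
  rw [← count_map_periodicItinerary, h2, hcount, hk]
  simp only [Quotient.out_eq]

/-- The product of the variables of the cycles that come from a necklace of multiplicity `k`. -/
def necklaceWeight {R : Type*} [CommSemiring R] (y : ℕ → R) (L : ℕ) (s : ℤ) (p k : ℕ) : R :=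
  ∏ i ∈ Finset.Icc 1 (2 * L), y i ^ necklaceCycles s p i k

-- Trade a pair for its fibre sizes; the cycle monomial then factors over necklaces. The bound `B`
-- keeps the index set finite without excluding any family of total size `n`.
open Classical in
theorem sum_compatiblePair_eq {R : Type*} [CommSemiring R] (y : ℕ → R) (hL : n.factorial ∣ L)
    {B : ℕ} (hB : n < B) :
    ∑ q : (Fin n → Fin (2 * m)) × Equiv.Perm (Fin n) with CompatiblePair q.1 q.2,
      ∏ i ∈ Finset.Icc 1 (2 * L), y i ^ cycleCount i q.2 =
    ∑ κ ∈ Fintype.piFinset fun _ : Necklace m L => Finset.range B with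
        ∑ O, wordPeriod (O.out : PeriodicWord (2 * m) L) * κ O = n,
      ∏ O, necklaceWeight y L (wordSign (O.out : PeriodicWord (2 * m) L))
        (wordPeriod (O.out : PeriodicWord (2 * m) L)) (κ O) := by
  refine Finset.sum_bij (fun q _ O => (fiber hL q.1 q.2 O.out).card) ?_ ?_ ?_ ?_
  · intro q _
    simp only [Finset.mem_filter, Fintype.mem_piFinset, Finset.mem_range]
    refine ⟨fun O => ?_, sum_wordPeriod_mul_card_fiber hL q.1 q.2⟩
    refine lt_of_le_of_lt (Finset.card_le_univ _) ?_
    rwa [Fintype.card_fin]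
  · intro q hq q' hq' h
    have := (Finset.mem_filter.1 hq).2.eq_of_card_fiber_eq (Finset.mem_filter.1 hq').2 hL
      (congrFun h)
    exact Prod.ext this.1 this.2
  · intro κ hκ
    obtain ⟨b, v, hbv, h⟩ := exists_compatiblePair_of_multiplicity hL κ (Finset.mem_filter.1 hκ).2
    exact ⟨(b, v), Finset.mem_filter.2 ⟨Finset.mem_univ _, hbv⟩, funext h⟩
  · intro q hq
    simp only [necklaceWeight]
    rw [Finset.prod_comm]
    refine Finset.prod_congr rfl fun i hi => ?_
    rw [Finset.prod_pow_eq_pow_sum,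
      (Finset.mem_filter.1 hq).2.cycleCount_eq hL (Finset.mem_Icc.1 hi).1]

end

/-! ### The product over necklaces, modulo a power of `u` -/

theorem sum_range_pow_mod_two_mul_pow_div_two {R : Type*} [CommSemiring R] (a b : R) (K : ℕ) :
    ∑ k ∈ Finset.range (2 * K), a ^ (k % 2) * b ^ (k / 2) =
      (1 + a) * ∑ k ∈ Finset.range K, b ^ k := by
  induction K with
  | zero => simp
  | succ K ih =>
    rw [show 2 * (K + 1) = 2 * K + 1 + 1 by ring, Finset.sum_range_succ, Finset.sum_range_succ, ih,
      Finset.sum_range_succ, show 2 * K % 2 = 0 by omega, show 2 * K / 2 = K by omega,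
      show (2 * K + 1) % 2 = 1 by omega, show (2 * K + 1) / 2 = K by omega]
    ring

section
variable {R : Type*} [CommRing R] {y : ℕ → R} {L p : ℕ}

theorem necklaceWeight_pos (hp : 0 < p) (hpL : p ≤ L) (k : ℕ) :
    necklaceWeight y L 1 p k = y p ^ k := by
  simp only [necklaceWeight, necklaceCycles, if_true]
  rw [Finset.prod_eq_single p]
  · simp
  · intro i _ hi
    simp [hi.symm]
  · intro h
    exact absurd (Finset.mem_Icc.2 ⟨hp, by omega⟩) h

theorem necklaceWeight_neg (hp : 0 < p) (hpL : p ≤ L) (k : ℕ) :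
    necklaceWeight y L (-1) p k = y p ^ (k % 2) * y (2 * p) ^ (k / 2) := by
  simp only [necklaceWeight, necklaceCycles, show (-1 : ℤ) ≠ 1 by norm_num, if_false, pow_add,
    Finset.prod_mul_distrib]
  congr 1
  · rw [Finset.prod_eq_single p]
    · simp
    · intro i _ hi
      simp [hi.symm]
    · intro h
      exact absurd (Finset.mem_Icc.2 ⟨hp, by omega⟩) h
  · rw [Finset.prod_eq_single (2 * p)]
    · simp
    · intro i _ hi
      simp [hi.symm]
    · intro h
      exact absurd (Finset.mem_Icc.2 ⟨by omega, by omega⟩) h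

variable {u : R} {N : ℕ}

/-- For either sign, `k` copies of a necklace of period `p` occupy `p * k` positions, so families of
total size above `N` can be discarded. -/
theorem pow_dvd_necklaceWeight (hy : ∀ i, u ^ i ∣ y i) (hp : 0 < p) (hpL : p ≤ L) {s : ℤ}
    (hs : s = 1 ∨ s = -1) (k : ℕ) : u ^ (p * k) ∣ necklaceWeight y L s p k := by
  rcases hs with rfl | rfl
  · rw [necklaceWeight_pos hp hpL, pow_mul]
    exact pow_dvd_pow_of_dvd (hy p) k
  · rw [necklaceWeight_neg hp hpL]
    have h : p * k = p * (k % 2) + 2 * p * (k / 2) := by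
      conv_lhs => rw [← Nat.mod_add_div k 2]
      ring
    rw [h, pow_add, pow_mul, pow_mul]
    exact mul_dvd_mul (pow_dvd_pow_of_dvd (hy p) _) (pow_dvd_pow_of_dvd (hy (2 * p)) _)

theorem eq_zero_of_pow_dvd (hu : u ^ (N + 1) = 0) {k : ℕ} (hk : N < k) {a : R} (ha : u ^ k ∣ a) :
    a = 0 := by
  obtain ⟨r, rfl⟩ := ha
  rw [pow_eq_zero_of_le hk hu, zero_mul]

theorem geom_sum_eq_of_mul_eq_one {a a' : R} (h : (1 - a) * a' = 1) {K : ℕ} (hK : a ^ K = 0) :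
    ∑ k ∈ Finset.range K, a ^ k = a' := by
  have h1 := mul_neg_geom_sum a K
  rw [hK, sub_zero] at h1
  calc _ = ((1 - a) * a') * ∑ k ∈ Finset.range K, a ^ k := by rw [h, one_mul]
    _ = a' * ((1 - a) * ∑ k ∈ Finset.range K, a ^ k) := by ring
    _ = a' := by rw [h1, mul_one]

variable {inv : ℕ → R}

/-- High powers of `y i` vanish, so truncated geometric sums are exact. The even cutoff makes the
parities of `k` pair up for negative necklaces. -/
theorem sum_necklaceWeight (hu : u ^ (N + 1) = 0) (hy : ∀ i, u ^ i ∣ y i)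
    (hinv : ∀ i, 0 < i → (1 - y i) * inv i = 1) (hp : 0 < p) (hpL : p ≤ L) {s : ℤ}
    (hs : s = 1 ∨ s = -1) :
    ∑ k ∈ Finset.range (2 * (N + 1)), necklaceWeight y L s p k =
      if s = 1 then inv p else (1 + y p) * inv (2 * p) := by
  have hpow : ∀ i K, 0 < i → N < K → y i ^ K = 0 := by
    intro i K hi hK
    refine eq_zero_of_pow_dvd hu (k := i * K) (hK.trans_le (Nat.le_mul_of_pos_left K hi)) ?_
    rw [pow_mul]
    exact pow_dvd_pow_of_dvd (hy i) K
  rcases hs with rfl | rfl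
  · simp only [necklaceWeight_pos hp hpL, if_true]
    exact geom_sum_eq_of_mul_eq_one (hinv p hp) (hpow p _ hp (by omega))
  · simp only [necklaceWeight_neg hp hpL]
    rw [sum_range_pow_mod_two_mul_pow_div_two, if_neg (by norm_num),
      geom_sum_eq_of_mul_eq_one (hinv (2 * p) (by omega)) (hpow _ _ (by omega) (by omega))]

theorem prod_inv_two_mul (hinv1 : ∀ i, N < i → inv i = 1) (f : ℕ → ℕ) :
    ∏ d ∈ Finset.Icc 1 N, inv (2 * d) ^ f d =
      ∏ d ∈ Finset.Icc 1 N, inv d ^ (if Even d then f (d / 2) else 0) := by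
  have h1 : ∏ d ∈ Finset.Icc 1 N, inv (2 * d) ^ f d =
      ∏ d ∈ Finset.Icc 1 N with 2 * d ≤ N, inv (2 * d) ^ f d := by
    rw [Finset.prod_filter]
    refine Finset.prod_congr rfl fun d _ => ?_
    split_ifs with h
    · rfl
    · rw [hinv1 _ (by omega), one_pow]
  have h2 : ∏ d ∈ Finset.Icc 1 N, inv d ^ (if Even d then f (d / 2) else 0) =
      ∏ d ∈ Finset.Icc 1 N with Even d, inv d ^ f (d / 2) := by
    rw [Finset.prod_filter]
    refine Finset.prod_congr rfl fun d _ => ?_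
    split_ifs <;> simp
  rw [h1, h2]
  refine Finset.prod_nbij' (fun d => 2 * d) (fun d => d / 2) ?_ ?_ ?_ ?_ ?_
  · intro d hd
    simp only [Finset.mem_filter, Finset.mem_Icc] at hd ⊢
    exact ⟨by omega, even_two_mul d⟩
  · intro d hd
    simp only [Finset.mem_filter, Finset.mem_Icc] at hd ⊢
    obtain ⟨e, rfl⟩ := even_iff_two_dvd.1 hd.2
    omega
  · intro d _
    exact Nat.mul_div_cancel_left _ two_pos
  · intro d hd
    exact Nat.mul_div_cancel' (even_iff_two_dvd.1 (Finset.mem_filter.1 hd).2)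
  · intro d _
    rw [Nat.mul_div_cancel_left _ two_pos]

/-- Necklaces of period above `N` contribute `1`; group the others by period. After reindexing by
doubling, the factors `inv (2 * d)` of the negative necklaces become the powers of `inv d` that the
positive necklaces lack. -/
theorem prod_necklace_eq [NeZero L] (m : ℕ) (hL : ∀ d, 0 < d → d ≤ N → d ∣ L)
    (hy0 : ∀ i, N < i → y i = 0) (hinv1 : ∀ i, N < i → inv i = 1) :
    ∏ O : Necklace m L, (if wordSign (O.out : PeriodicWord (2 * m) L) = 1
      then inv (wordPeriod (O.out : PeriodicWord (2 * m) L))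
      else (1 + y (wordPeriod (O.out : PeriodicWord (2 * m) L))) *
        inv (2 * wordPeriod (O.out : PeriodicWord (2 * m) L))) =
    ∏ i ∈ Finset.Icc 1 N, ((1 + y i) * inv i) ^ cycleExponent i m := by
  classical
  set P : Necklace m L → ℕ := fun O => wordPeriod (O.out : PeriodicWord (2 * m) L) with hP
  set S : Necklace m L → ℤ := fun O => wordSign (O.out : PeriodicWord (2 * m) L) with hS
  change ∏ O : Necklace m L, (if S O = 1 then inv (P O) else (1 + y (P O)) * inv (2 * P O)) = _
  have hS1 : ∀ O, ¬ S O = 1 ↔ S O = -1 := fun O => by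
    rcases wordSign_eq_or (O.out : PeriodicWord (2 * m) L) with h | h <;> simp [hS, h]
  have h1 : ∏ O : Necklace m L, (if S O = 1 then inv (P O) else (1 + y (P O)) * inv (2 * P O)) =
      ∏ O : Necklace m L with P O ∈ Finset.Icc 1 N,
        (if S O = 1 then inv (P O) else (1 + y (P O)) * inv (2 * P O)) := by
    rw [Finset.prod_filter]
    refine Finset.prod_congr rfl fun O _ => ?_
    split_ifs with h2 h3 h3
    · rfl
    · rw [hinv1]
      have : 0 < P O := wordPeriod_pos _
      rw [Finset.mem_Icc] at h3
      omega
    · rfl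
    · have : 0 < P O := wordPeriod_pos _
      rw [Finset.mem_Icc] at h3
      rw [hinv1 _ (by omega), hy0 _ (by omega)]
      simp
  rw [h1, ← Finset.prod_fiberwise_of_maps_to (t := Finset.Icc 1 N) (g := P)
    (fun O hO => (Finset.mem_filter.1 hO).2)]
  have h2 : ∀ d ∈ Finset.Icc 1 N, (∏ O ∈ Finset.univ.filter (fun O => P O ∈ Finset.Icc 1 N) with
      P O = d, (if S O = 1 then inv (P O) else (1 + y (P O)) * inv (2 * P O))) =
      inv d ^ necklaceCount m L 1 d * (1 + y d) ^ cycleExponent d m *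
        inv (2 * d) ^ cycleExponent d m := by
    intro d hd
    have hd' := Finset.mem_Icc.1 hd
    rw [Finset.filter_filter, Finset.prod_congr rfl
      (g := fun O => if S O = 1 then inv d else (1 + y d) * inv (2 * d))
      (fun O hO => by rw [(Finset.mem_filter.1 hO).2.2]),
      Finset.prod_ite, Finset.prod_const, Finset.prod_const, Finset.filter_filter,
      Finset.filter_filter,
      ← necklaceCount_neg (by omega) (hL d (by omega) hd'.2), necklaceCount, necklaceCount, mul_assoc,
      ← mul_pow]
    congr 3
    · refine Finset.filter_congr fun O _ => ?_
      exact ⟨fun h => ⟨h.1.2, h.2⟩, fun h => ⟨⟨(show P O = d from h.1).symm ▸ hd, h.1⟩, h.2⟩⟩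
    · refine Finset.filter_congr fun O _ => ?_
      rw [hS1]
      exact ⟨fun h => ⟨h.1.2, h.2⟩, fun h => ⟨⟨(show P O = d from h.1).symm ▸ hd, h.1⟩, h.2⟩⟩
  rw [Finset.prod_congr rfl h2, Finset.prod_mul_distrib, prod_inv_two_mul hinv1 fun d => cycleExponent d m,
    ← Finset.prod_mul_distrib]
  refine Finset.prod_congr rfl fun d hd => ?_
  have hd' := Finset.mem_Icc.1 hd
  have h3 : inv d ^ cycleExponent d m = inv d ^ necklaceCount m L 1 d *
      inv d ^ (if Even d then cycleExponent (d / 2) m else 0) := by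
    rw [← pow_add, necklaceCount_pos (by omega) (hL d (by omega) hd'.2)]
  rw [mul_pow, h3]
  ring

-- The period bound `L = N!` is a multiple of every `n!` with `n ≤ N` and of every period up to `N`.
-- Expand the product of sums into families of multiplicities and sort them by total size; sizes
-- above `N` vanish.
open Classical in
theorem prod_eq_sum_compatiblePair (m : ℕ) (hu : u ^ (N + 1) = 0) (hy : ∀ i, u ^ i ∣ y i)
    (hinv : ∀ i, 0 < i → (1 - y i) * inv i = 1) :
    ∏ i ∈ Finset.Icc 1 N, ((1 + y i) * inv i) ^ cycleExponent i m =
    ∑ n ∈ Finset.range (N + 1),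
      ∑ q : (Fin n → Fin (2 * m)) × Equiv.Perm (Fin n) with CompatiblePair q.1 q.2,
        ∏ i ∈ Finset.Icc 1 (2 * N.factorial), y i ^ cycleCount i q.2 := by
  have : NeZero N.factorial := ⟨Nat.factorial_ne_zero N⟩
  have hy0 : ∀ i, N < i → y i = 0 := fun i hi => eq_zero_of_pow_dvd hu hi (hy i)
  have hinv1 : ∀ i, N < i → inv i = 1 := fun i hi => by
    have := hinv i (by omega)
    rwa [hy0 i hi, sub_zero, one_mul] at this
  have hle : ∀ O : Necklace m N.factorial,
      wordPeriod (O.out : PeriodicWord (2 * m) N.factorial) ≤ N.factorial := fun O =>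
    Nat.le_of_dvd (Nat.factorial_pos N) (wordPeriod_dvd _)
  rw [Finset.sum_congr rfl fun n hn => sum_compatiblePair_eq y
    (Nat.factorial_dvd_factorial (Nat.lt_succ_iff.1 (Finset.mem_range.1 hn)))
    (B := 2 * (N + 1)) (by have := Finset.mem_range.1 hn; omega)]
  rw [← prod_necklace_eq (L := N.factorial) m
    (fun d hd hdN => Nat.dvd_factorial hd hdN) hy0 hinv1]
  rw [Finset.prod_congr rfl fun O _ => (sum_necklaceWeight hu hy hinv (wordPeriod_pos _) (hle O)
    (wordSign_eq_or _)).symm, Finset.prod_univ_sum]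
  symm
  rw [← Finset.sum_filter_of_ne (p := fun κ : Necklace m N.factorial → ℕ => ∑ O : Necklace m N.factorial,
    wordPeriod (O.out : PeriodicWord (2 * m) N.factorial) * κ O ∈ Finset.range (N + 1)),
    ← Finset.sum_fiberwise_of_maps_to (t := Finset.range (N + 1))
    (g := fun κ : Necklace m N.factorial → ℕ => ∑ O : Necklace m N.factorial,
      wordPeriod (O.out : PeriodicWord (2 * m) N.factorial) * κ O)
    (fun κ hκ => (Finset.mem_filter.1 hκ).2)]
  · refine Finset.sum_congr rfl fun n hn => ?_
    rw [Finset.filter_filter]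
    refine Finset.sum_congr (Finset.filter_congr fun κ _ => ?_) fun _ _ => rfl
    exact ⟨fun h => ⟨h.symm ▸ hn, h⟩, fun h => h.2⟩
  · intro κ _ h
    by_contra hlt
    rw [Finset.mem_range, not_lt] at hlt
    refine h (eq_zero_of_pow_dvd hu (k := ∑ O : Necklace m N.factorial,
      wordPeriod (O.out : PeriodicWord (2 * m) N.factorial) * κ O) (by omega) ?_)
    rw [← Finset.prod_pow_eq_pow_sum]
    exact Finset.prod_dvd_prod_of_dvd _ _ fun O _ =>
      pow_dvd_necklaceWeight hy (wordPeriod_pos _) (hle O) (wordSign_eq_or _) _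

end

/-! ### Valleys and peaks -/

theorem cycleCount_conj {n : ℕ} (w r : Equiv.Perm (Fin n)) (i : ℕ) :
    cycleCount i (r * w * r⁻¹) = cycleCount i w := by
  rw [cycleCount, cycleCount, Equiv.Perm.parts_partition, Equiv.Perm.parts_partition,
    ← Equiv.Perm.sum_cycleType, ← Equiv.Perm.sum_cycleType, Equiv.Perm.cycleType_conj]

/-- Reversing values exchanges valleys and peaks; reversing positions keeps them and turns the
operation into a conjugation. -/
theorem valleyCount_conj_rev {n : ℕ} (w : Equiv.Perm (Fin n)) :
    valleyCount (Fin.revPerm * w * Fin.revPerm⁻¹) = peakCount w := by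
  have h : ∀ i : Fin n, (Fin.revPerm * w * Fin.revPerm⁻¹ : Equiv.Perm (Fin n)) i = (w i.rev).rev := fun i => rfl
  refine Finset.card_nbij' Fin.rev Fin.rev ?_ ?_ (fun i _ => Fin.rev_rev i)
    (fun i _ => Fin.rev_rev i)
  · intro i hi
    simp only [Finset.coe_filter, Finset.mem_univ, true_and, Set.mem_ofPred_eq, h,
      Fin.rev_lt_rev] at hi ⊢
    obtain ⟨a, b, ha, hb, h1, h2⟩ := hi
    refine ⟨b.rev, a.rev, ?_, ?_, h2, h1⟩
    · simp only [Fin.val_rev]; omega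
    · simp only [Fin.val_rev]; omega
  · intro i hi
    simp only [Finset.coe_filter, Finset.mem_univ, true_and, Set.mem_ofPred_eq, h,
      Fin.rev_lt_rev, Fin.rev_rev] at hi ⊢
    obtain ⟨a, b, ha, hb, h1, h2⟩ := hi
    refine ⟨b.rev, a.rev, ?_, ?_, by simpa using h2, by simpa using h1⟩
    · simp only [Fin.val_rev]; omega
    · simp only [Fin.val_rev]; omega

theorem permTerm_valleyCount (K : Type*) [Field K] (n : ℕ) :
    permTerm K (fun _ w => valleyCount w) n = permTerm K (fun _ w => peakCount w) n := by
  rw [permTerm, permTerm, ← (MulAut.conj (Fin.revPerm (n := n))).toEquiv.sum_comp]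
  congr 1
  refine Finset.sum_congr rfl fun w _ => ?_
  have h : (MulAut.conj (Fin.revPerm (n := n))).toEquiv w = Fin.revPerm * w * Fin.revPerm⁻¹ := rfl
  simp only [h, valleyCount_conj_rev, cycleCount_conj]

/-! ### Convergence of series and products -/

section Topology
variable {K : Type*} [Field K] [TopologicalSpace K]

omit [TopologicalSpace K] in
theorem coeff_eq_of_X_pow_dvd_sub {s : GenVar} {k : ℕ} {f g : MvPowerSeries GenVar K}
    (h : MvPowerSeries.X s ^ k ∣ f - g) {e : GenVar →₀ ℕ} (he : e s < k) :
    MvPowerSeries.coeff e f = MvPowerSeries.coeff e g := by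
  rw [← sub_eq_zero, ← map_sub]
  exact MvPowerSeries.X_pow_dvd_iff.1 h e he

/-- The set of the first `k` positive integers. -/
def firstPNats (k : ℕ) : Finset ℕ+ :=
  (Finset.range k).map ⟨Nat.succPNat, Nat.succPNat_injective⟩

theorem mem_firstPNats {k : ℕ} {n : ℕ+} : n ∈ firstPNats k ↔ (n : ℕ) ≤ k := by
  simp only [firstPNats, Finset.mem_map, Finset.mem_range, Function.Embedding.coeFn_mk]
  constructor
  · rintro ⟨a, ha, rfl⟩
    exact ha
  · intro h
    exact ⟨n.natPred, by have := n.natPred_add_one; omega, PNat.succPNat_natPred n⟩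

/-- A series whose `n`-th term is divisible by the `n`-th power of a variable converges. -/
theorem exists_hasSum_of_X_pow_dvd (s : GenVar) {f : ℕ+ → MvPowerSeries GenVar K}
    (hf : ∀ n : ℕ+, MvPowerSeries.X s ^ (n : ℕ) ∣ f n) :
    ∃ a, HasSum f a ∧ ∀ k, MvPowerSeries.X s ^ (k + 1) ∣ a - ∑ n ∈ firstPNats k, f n := by
  have key : ∀ (e : GenVar →₀ ℕ) (t : Finset ℕ+), firstPNats (e s) ⊆ t →
      MvPowerSeries.coeff e (∑ n ∈ t, f n) =
        MvPowerSeries.coeff e (∑ n ∈ firstPNats (e s), f n) := by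
    intro e t ht
    rw [← Finset.sum_sdiff ht, map_add, map_sum, Finset.sum_eq_zero, zero_add]
    intro n hn
    refine MvPowerSeries.X_pow_dvd_iff.1 (hf n) e ?_
    rw [Finset.mem_sdiff, mem_firstPNats] at hn
    omega
  obtain ⟨a, ha⟩ : ∃ a : MvPowerSeries GenVar K, ∀ e, MvPowerSeries.coeff e a =
      MvPowerSeries.coeff e (∑ n ∈ firstPNats (e s), f n) := ⟨fun e => _, fun _ => rfl⟩
  refine ⟨a, ?_, fun k => ?_⟩
  · change Filter.Tendsto _ (SummationFilter.unconditional _).filter _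
    rw [SummationFilter.unconditional_filter, MvPowerSeries.WithPiTopology.tendsto_iff_coeff_tendsto]
    intro e
    refine tendsto_const_nhds.congr' ?_
    filter_upwards [Filter.eventually_ge_atTop (firstPNats (e s))] with t ht
    rw [key e t ht, ha]
  · rw [MvPowerSeries.X_pow_dvd_iff]
    intro e he
    rw [map_sub, sub_eq_zero, ha, key e (firstPNats k) fun n hn => by
      rw [mem_firstPNats] at hn ⊢; omega]

/-- A product whose `n`-th factor is congruent to `1` modulo the `n`-th power of a variable
converges. -/
theorem exists_hasProd_of_X_pow_dvd (s : GenVar) {f : ℕ+ → MvPowerSeries GenVar K}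
    (hf : ∀ n : ℕ+, MvPowerSeries.X s ^ (n : ℕ) ∣ f n - 1) :
    ∃ a, HasProd f a ∧ ∀ k, MvPowerSeries.X s ^ (k + 1) ∣ a - ∏ n ∈ firstPNats k, f n := by
  have key : ∀ (e : GenVar →₀ ℕ) (t : Finset ℕ+), firstPNats (e s) ⊆ t →
      MvPowerSeries.coeff e (∏ n ∈ t, f n) =
        MvPowerSeries.coeff e (∏ n ∈ firstPNats (e s), f n) := by
    intro e t ht
    refine coeff_eq_of_X_pow_dvd_sub (s := s) (k := e s + 1) ?_ (Nat.lt_succ_self _)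
    rw [← Finset.prod_sdiff ht, ← sub_one_mul]
    refine Dvd.dvd.mul_right ?_ _
    have : ∀ r : Finset ℕ+, (∀ n ∈ r, e s + 1 ≤ (n : ℕ)) →
        MvPowerSeries.X s ^ (e s + 1) ∣ (∏ n ∈ r, f n) - 1 := by
      intro r
      induction r using Finset.induction_on with
      | empty => simp
      | insert n r hn ih =>
        intro hr
        rw [Finset.prod_insert hn, show f n * ∏ n ∈ r, f n - 1 =
          (f n - 1) * ∏ n ∈ r, f n + (∏ n ∈ r, f n - 1) by ring]
        exact dvd_add (Dvd.dvd.mul_right ((pow_dvd_pow _ (hr n (Finset.mem_insert_self n r))).trans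
          (hf n)) _) (ih fun k hk => hr k (Finset.mem_insert_of_mem hk))
    refine this _ fun n hn => ?_
    rw [Finset.mem_sdiff, mem_firstPNats] at hn
    omega
  obtain ⟨a, ha⟩ : ∃ a : MvPowerSeries GenVar K, ∀ e, MvPowerSeries.coeff e a =
      MvPowerSeries.coeff e (∏ n ∈ firstPNats (e s), f n) := ⟨fun e => _, fun _ => rfl⟩
  refine ⟨a, ?_, fun k => ?_⟩
  · change Filter.Tendsto _ (SummationFilter.unconditional _).filter _
    rw [SummationFilter.unconditional_filter, MvPowerSeries.WithPiTopology.tendsto_iff_coeff_tendsto]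
    intro e
    refine tendsto_const_nhds.congr' ?_
    filter_upwards [Filter.eventually_ge_atTop (firstPNats (e s))] with t ht
    rw [key e t ht, ha]
  · rw [MvPowerSeries.X_pow_dvd_iff]
    intro e he
    rw [map_sub, sub_eq_zero, ha, key e (firstPNats k) fun n hn => by
      rw [mem_firstPNats] at hn ⊢; omega]

end Topology

/-! ### Comparison of the two sides -/

section Assembly
variable (K : Type*) [Field K]

/-- The monomial of the cycle type of a permutation. -/
noncomputable def cycleMonomial {n : ℕ} (w : Equiv.Perm (Fin n)) : MvPowerSeries GenVar K :=
  ∏ᶠ i : ℕ+, xVar K i ^ cycleCount i w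

/-- The series `x_i u^i`, indexed by the natural numbers. -/
noncomputable def cycleVar (i : ℕ) : MvPowerSeries GenVar K := xVar K i.toPNat' * uVar K ^ i

/-- The sum of the cycle monomials of the permutations of `n` symbols, each weighted by its number
of compatible words over `2m` letters. -/
noncomputable def weightedCycleSum (m n : ℕ) : MvPowerSeries GenVar K :=
  ∑ w : Equiv.Perm (Fin n), ((compatWords (permSeq w) n (2 * m)).card : MvPowerSeries GenVar K) *
    cycleMonomial K w

theorem le_of_cycleCount_ne_zero {n i : ℕ} {w : Equiv.Perm (Fin n)} (h : cycleCount i w ≠ 0) :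
    i ≤ n := by
  have h1 := Nat.Partition.le_of_mem_parts (Multiset.count_pos.1 (Nat.pos_of_ne_zero h))
  rwa [Fintype.card_fin] at h1

theorem sum_mul_cycleCount {n B : ℕ} (hB : n ≤ B) (w : Equiv.Perm (Fin n)) :
    ∑ i ∈ Finset.Icc 1 B, i * cycleCount i w = n := by
  have h1 : w.partition.parts.sum = n := w.partition.parts_sum.trans (Fintype.card_fin n)
  rw [Finset.sum_multiset_count_of_subset _ (Finset.Icc 1 B)] at h1
  · refine Eq.trans (Finset.sum_congr rfl fun i _ => mul_comm _ _) h1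
  · intro i hi
    rw [Multiset.mem_toFinset] at hi
    have h2 := Nat.Partition.le_of_mem_parts hi
    rw [Fintype.card_fin] at h2
    exact Finset.mem_Icc.2 ⟨w.partition.parts_pos hi, h2.trans hB⟩

/-- The cycle lengths add up to `n`, which collects the powers of `u`. Only positive indices occur,
so the value of `toPNat'` at `0` is harmless. -/
theorem prod_cycleVar_pow {n B : ℕ} (hB : n ≤ B) (w : Equiv.Perm (Fin n)) :
    ∏ i ∈ Finset.Icc 1 B, cycleVar K i ^ cycleCount i w = uVar K ^ n * cycleMonomial K w := by
  simp only [cycleVar, mul_pow, Finset.prod_mul_distrib, ← pow_mul]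
  rw [Finset.prod_pow_eq_pow_sum, sum_mul_cycleCount hB, mul_comm]
  congr 1
  rw [cycleMonomial, finprod_eq_prod_of_mulSupport_subset (s := (Finset.Icc 1 B).image Nat.toPNat'),
    Finset.prod_image]
  · refine Finset.prod_congr rfl fun i hi => ?_
    rw [Nat.toPNat'_coe, if_pos (show 0 < i from (Finset.mem_Icc.1 hi).1)]
  · intro i hi j hj hij
    have h1 := congrArg PNat.val hij
    simp only [Finset.coe_Icc, Set.mem_Icc] at hi hj
    simpa [Nat.toPNat'_coe, show 0 < i by omega, show 0 < j by omega] using h1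
  · intro i hi
    have h1 : cycleCount i w ≠ 0 := fun h => hi (by simp [h])
    rw [Finset.coe_image]
    refine ⟨i, Finset.mem_coe.2 (Finset.mem_Icc.2 ⟨i.pos, (le_of_cycleCount_ne_zero h1).trans hB⟩), ?_⟩
    simp

open Classical in
theorem card_compatiblePair {n : ℕ} (c : ℕ) (w : Equiv.Perm (Fin n)) :
    (Finset.univ.filter fun b : Fin n → Fin c => CompatiblePair b w).card =
      (compatWords (permSeq w) n c).card := by
  refine Finset.card_bij (fun b _ j => (b j : ℕ)) ?_ ?_ ?_
  · intro b hb
    rw [mem_compatWords]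
    refine ⟨fun j => (b j).2, ?_⟩
    simp only [permSeq_val]
    exact (Finset.mem_filter.1 hb).2
  · intro b _ b' _ h
    exact funext fun j => Fin.ext (congrFun h j)
  · intro b hb
    rw [mem_compatWords] at hb
    simp only [permSeq_val] at hb
    exact ⟨fun j => ⟨b j, hb.1 j⟩, Finset.mem_filter.2 ⟨Finset.mem_univ _, hb.2⟩, rfl⟩

open Classical in
theorem sum_compatiblePair_cycleVar (m : ℕ) {n B : ℕ} (hB : n ≤ B) :
    ∑ q : (Fin n → Fin (2 * m)) × Equiv.Perm (Fin n) with CompatiblePair q.1 q.2,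
      ∏ i ∈ Finset.Icc 1 B, cycleVar K i ^ cycleCount i q.2 =
    uVar K ^ n * weightedCycleSum K m n := by
  rw [Finset.sum_filter, Fintype.sum_prod_type_right, weightedCycleSum, Finset.mul_sum]
  refine Finset.sum_congr rfl fun w _ => ?_
  simp only [prod_cycleVar_pow K hB]
  rw [← Finset.sum_filter, Finset.sum_const, card_compatiblePair, nsmul_eq_mul]
  ring

theorem constantCoeff_one_sub_cycleVar {i : ℕ} (hi : 0 < i) :
    MvPowerSeries.constantCoeff (1 - cycleVar K i) ≠ 0 := by
  simp [cycleVar, uVar, hi.ne']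

theorem prod_firstPNats_cycleFactor (m : ℕ+) (N : ℕ) :
    ∏ i ∈ firstPNats N, cycleFactor K m i = ∏ i ∈ Finset.Icc 1 N,
      ((1 + cycleVar K i) * (1 - cycleVar K i)⁻¹) ^ cycleExponent i m := by
  refine Finset.prod_nbij' (fun i => (i : ℕ)) (fun i => i.toPNat') ?_ ?_ ?_ ?_ ?_
  · intro i hi
    rw [mem_firstPNats] at hi
    exact Finset.mem_Icc.2 ⟨i.pos, hi⟩
  · intro i hi
    have := Finset.mem_Icc.1 hi
    rw [mem_firstPNats, Nat.toPNat'_coe, if_pos (show 0 < i from this.1)]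
    exact this.2
  · intro i _
    simp
  · intro i hi
    rw [Nat.toPNat'_coe, if_pos (show 0 < i from (Finset.mem_Icc.1 hi).1)]
  · intro i _
    simp [cycleFactor, cycleVar]

/-- In the quotient by `u^(N+1)` the variable `u` is nilpotent, as `prod_eq_sum_compatiblePair`
requires. -/
theorem prod_cycleFactor_congr (m : ℕ+) (N : ℕ) :
    uVar K ^ (N + 1) ∣ (∏ i ∈ firstPNats N, cycleFactor K m i) -
      ∑ n ∈ Finset.range (N + 1), uVar K ^ n * weightedCycleSum K m n := by
  classical
  rw [← Ideal.mem_span_singleton, ← Ideal.Quotient.mk_eq_mk_iff_sub_mem,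
    prod_firstPNats_cycleFactor]
  set π := Ideal.Quotient.mk (Ideal.span {uVar K ^ (N + 1)})
  have h := prod_eq_sum_compatiblePair (R := MvPowerSeries GenVar K ⧸ Ideal.span {uVar K ^ (N + 1)})
    (N := N) (u := π (uVar K)) (y := fun i => π (cycleVar K i))
    (inv := fun i => π ((1 - cycleVar K i)⁻¹)) m
    (by rw [← map_pow]; exact Ideal.Quotient.eq_zero_iff_mem.2 (Ideal.mem_span_singleton_self _))
    (fun i => by rw [← map_pow]; exact map_dvd π (dvd_mul_left _ _))
    (fun i hi => by
      rw [← map_one π, ← map_sub, ← map_mul,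
        MvPowerSeries.mul_inv_cancel _ (constantCoeff_one_sub_cycleVar K hi)])
  rw [map_prod, map_sum]
  simp only [map_pow, map_mul, map_add, map_one] at h ⊢
  rw [h]
  refine Finset.sum_congr rfl fun n hn => ?_
  have hB : n ≤ 2 * N.factorial := by
    have := Nat.self_le_factorial N
    have := Finset.mem_range.1 hn
    omega
  rw [← map_pow, ← map_mul, ← sum_compatiblePair_cycleVar K m hB, map_sum]
  simp only [map_prod, map_pow]

theorem X_pow_dvd_cycleFactor_sub_one (m i : ℕ+) :
    uVar K ^ (i : ℕ) ∣ cycleFactor K m i - 1 := by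
  have h0 : MvPowerSeries.constantCoeff (1 - xVar K i * uVar K ^ (i : ℕ)) ≠ 0 := by
    simp [uVar]
  have h1 := MvPowerSeries.mul_inv_cancel _ h0
  have h2 : (1 + xVar K i * uVar K ^ (i : ℕ)) * (1 - xVar K i * uVar K ^ (i : ℕ))⁻¹ - 1 =
      uVar K ^ (i : ℕ) * (2 * xVar K i * (1 - xVar K i * uVar K ^ (i : ℕ))⁻¹) := by
    linear_combination h1
  refine Dvd.dvd.trans ⟨_, h2⟩ ?_
  have := sub_dvd_pow_sub_pow
    ((1 + xVar K i * uVar K ^ (i : ℕ)) * (1 - xVar K i * uVar K ^ (i : ℕ))⁻¹) 1 (cycleExponent i m)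
  rwa [one_pow] at this

/-- The substitution of the variable `t` in a power series. -/
noncomputable def substT : PowerSeries K →ₐ[K] MvPowerSeries GenVar K :=
  PowerSeries.substAlgHom (PowerSeries.HasSubst.X GenVar.t)

theorem substT_X : substT K PowerSeries.X = tVar K := by
  rw [substT, PowerSeries.coe_substAlgHom, PowerSeries.subst_X (PowerSeries.HasSubst.X GenVar.t)]
  rfl

theorem substT_inv {f : PowerSeries K} (hf : PowerSeries.constantCoeff f ≠ 0)
    (hf' : MvPowerSeries.constantCoeff (substT K f) ≠ 0) : substT K f⁻¹ = (substT K f)⁻¹ := by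
  rw [MvPowerSeries.eq_inv_iff_mul_eq_one hf', ← map_mul, PowerSeries.inv_mul_cancel _ hf, map_one]

theorem substT_congr (f : PowerSeries K) (M : ℕ) :
    tVar K ^ M ∣ substT K f - ∑ k ∈ Finset.range M,
      MvPowerSeries.C (PowerSeries.coeff k f) * tVar K ^ k := by
  have h : PowerSeries.X ^ M ∣ f - ∑ k ∈ Finset.range M,
      algebraMap K (PowerSeries K) (PowerSeries.coeff k f) * PowerSeries.X ^ k := by
    rw [PowerSeries.X_pow_dvd_iff]
    intro j hj
    rw [map_sub, map_sum, Finset.sum_eq_single j]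
    · simp [PowerSeries.coeff_C_mul, PowerSeries.coeff_X_pow]
    · intro k _ hk
      simp [PowerSeries.coeff_C_mul, PowerSeries.coeff_X_pow, hk.symm]
    · intro h
      exact absurd (Finset.mem_range.2 hj) h
  have h1 := map_dvd (substT K) h
  simp only [map_pow, map_sub, map_sum, map_mul, substT_X, AlgHom.commutes] at h1
  exact h1

theorem C_half_mul_eq_substT [CharZero K] {n : ℕ} (hn : 0 < n) (w : Equiv.Perm (Fin n)) :
    MvPowerSeries.C (1 / 2 : K) * ((1 + tVar K) ^ (n + 1) * ((1 - tVar K) ^ (n + 1))⁻¹) *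
      (4 * tVar K * ((1 + tVar K) ^ 2)⁻¹) ^ (peakCount w + 1) =
    substT K (evenSeries K (permSeq w) n) := by
  rw [← evenSeries_permSeq K hn w]
  have h1 : substT K ((1 - PowerSeries.X) ^ (n + 1))⁻¹ = ((1 - tVar K) ^ (n + 1))⁻¹ := by
    rw [substT_inv _ (by simp) (by simp [substT_X, tVar])]
    simp [substT_X]
  have h2 : substT K ((1 + PowerSeries.X) ^ 2)⁻¹ = ((1 + tVar K) ^ 2)⁻¹ := by
    rw [substT_inv _ (by simp) (by simp [substT_X, tVar])]
    simp [substT_X]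
  have h3 : substT K (PowerSeries.C (1 / 2 : K)) = MvPowerSeries.C (1 / 2 : K) :=
    (substT K).commutes _
  simp only [map_mul, map_pow, map_add, map_one, h1, h2, h3, substT_X, map_ofNat]

theorem sum_range_succ_eq_sum_firstPNats {M : ℕ} (f : ℕ → MvPowerSeries GenVar K) (h0 : f 0 = 0) :
    ∑ k ∈ Finset.range (M + 1), f k = ∑ m ∈ firstPNats M, f m := by
  rw [Finset.sum_range_succ', h0, add_zero, firstPNats, Finset.sum_map]
  rfl

/-- The coefficient of `t^k` in the prefactor of `w` is the number of compatible words over `2k`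
letters. The term `k = 0` drops out, as the empty alphabet has no words of positive length. -/
theorem permTerm_congr [CharZero K] (n : ℕ+) (M : ℕ) :
    tVar K ^ (M + 1) ∣ permTerm K (fun _ w => peakCount w) n -
      ∑ m ∈ firstPNats M, tVar K ^ (m : ℕ) * (uVar K ^ (n : ℕ) * weightedCycleSum K m n) := by
  have h0 : weightedCycleSum K 0 n = 0 := by
    refine Finset.sum_eq_zero fun w _ => ?_
    have : (compatWords (permSeq w) n (2 * 0)).card = 0 := by
      rw [mul_zero, Finset.card_eq_zero, Finset.eq_empty_iff_forall_notMem]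
      intro b hb
      exact Nat.not_lt_zero _ ((mem_compatWords.1 hb).1 ⟨0, n.pos⟩)
    rw [this, Nat.cast_zero, zero_mul]
  rw [← sum_range_succ_eq_sum_firstPNats K
    (fun m => tVar K ^ m * (uVar K ^ (n : ℕ) * weightedCycleSum K m n)) (by rw [h0]; ring)]
  have h1 : ∑ k ∈ Finset.range (M + 1), tVar K ^ k * (uVar K ^ (n : ℕ) * weightedCycleSum K k n) =
      uVar K ^ (n : ℕ) * ∑ w : Equiv.Perm (Fin n), (∑ k ∈ Finset.range (M + 1),
        MvPowerSeries.C (PowerSeries.coeff k (evenSeries K (permSeq w) n)) * tVar K ^ k) *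
        cycleMonomial K w := by
    simp only [weightedCycleSum, Finset.mul_sum, Finset.sum_mul]
    rw [Finset.sum_comm]
    refine Finset.sum_congr rfl fun w _ => Finset.sum_congr rfl fun k _ => ?_
    rw [evenSeries, PowerSeries.coeff_mk, map_natCast]
    ring
  rw [h1, permTerm, ← mul_sub, ← Finset.sum_sub_distrib]
  refine Dvd.dvd.mul_left (Finset.dvd_sum fun w _ => ?_) _
  rw [C_half_mul_eq_substT K n.pos, cycleMonomial, ← sub_mul]
  exact Dvd.dvd.mul_right (substT_congr K _ _) _

theorem weightedCycleSum_zero (m : ℕ) : weightedCycleSum K m 0 = 1 := by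
  have h1 : ∀ w : Equiv.Perm (Fin 0), (compatWords (permSeq w) 0 (2 * m)).card = 1 := by
    intro w
    rw [Finset.card_eq_one]
    refine ⟨Fin.elim0, ?_⟩
    ext b
    simp only [mem_compatWords, Finset.mem_singleton]
    exact ⟨fun _ => Subsingleton.elim _ _, fun _ => ⟨fun j => j.elim0, fun j => j.elim0⟩⟩
  have h2 : ∀ w : Equiv.Perm (Fin 0), cycleMonomial K w = 1 := by
    intro w
    rw [cycleMonomial]
    refine finprod_eq_one_of_forall_eq_one fun i => ?_
    have : cycleCount i w = 0 := by
      by_contra h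
      exact absurd (le_of_cycleCount_ne_zero h) (by have := i.pos; omega)
    rw [this, pow_zero]
  rw [weightedCycleSum, Fintype.sum_unique, h1, h2]
  simp

theorem tVar_mul_inv_congr (M : ℕ) :
    tVar K ^ (M + 1) ∣ tVar K * (1 - tVar K)⁻¹ - ∑ m ∈ firstPNats M, tVar K ^ (m : ℕ) := by
  have h1 := MvPowerSeries.mul_inv_cancel (1 - tVar K) (by simp [tVar])
  have h2 : ∑ m ∈ firstPNats M, tVar K ^ (m : ℕ) =
      tVar K * ∑ k ∈ Finset.range M, tVar K ^ k := by
    rw [firstPNats, Finset.sum_map, Finset.mul_sum]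
    exact Finset.sum_congr rfl fun k _ => pow_succ' _ _
  have h3 := mul_neg_geom_sum (tVar K) M
  refine ⟨(1 - tVar K)⁻¹, ?_⟩
  rw [h2]
  set G := ∑ k ∈ Finset.range M, tVar K ^ k
  linear_combination tVar K * G * h1 - tVar K * (1 - tVar K)⁻¹ * h3

end Assembly

theorem mainTheorem12 (K : Type*) [Field K] [CharZero K] [TopologicalSpace K]
    [DiscreteTopology K] :
    (∀ m : ℕ+, Multipliable fun i : ℕ+ => cycleFactor K m i) ∧
    (Summable fun m : ℕ+ => tVar K ^ (m : ℕ) * ∏' i : ℕ+, cycleFactor K m i) ∧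
    ((Summable fun n : ℕ+ => permTerm K (fun _ w => valleyCount w) n) ∧
      tVar K * (1 - tVar K)⁻¹ + ∑' n : ℕ+, permTerm K (fun _ w => valleyCount w) n =
        ∑' m : ℕ+, tVar K ^ (m : ℕ) * ∏' i : ℕ+, cycleFactor K m i) ∧
    ((Summable fun n : ℕ+ => permTerm K (fun _ w => peakCount w) n) ∧
      tVar K * (1 - tVar K)⁻¹ + ∑' n : ℕ+, permTerm K (fun _ w => peakCount w) n =
        ∑' m : ℕ+, tVar K ^ (m : ℕ) * ∏' i : ℕ+, cycleFactor K m i) := by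
  -- The valley identity becomes the peak identity.
  simp only [permTerm_valleyCount]
  choose a ha1 ha2 using fun m => exists_hasProd_of_X_pow_dvd GenVar.u
    (X_pow_dvd_cycleFactor_sub_one K m)
  have ha : ∀ m, ∏' i : ℕ+, cycleFactor K m i = a m := fun m => (ha1 m).tprod_eq
  obtain ⟨G, hG1, hG2⟩ := exists_hasSum_of_X_pow_dvd GenVar.t
    (f := fun m : ℕ+ => tVar K ^ (m : ℕ) * a m) (fun m => dvd_mul_right _ _)
  obtain ⟨P, hP1, hP2⟩ := exists_hasSum_of_X_pow_dvd GenVar.u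
    (f := fun n : ℕ+ => permTerm K (fun _ w => peakCount w) n) (fun n => dvd_mul_right _ _)
  simp only [ha]
  rw [hG1.tsum_eq, hP1.tsum_eq]
  suffices h : tVar K * (1 - tVar K)⁻¹ + P = G from
    ⟨fun m => (ha1 m).multipliable, hG1.summable, ⟨hP1.summable, h⟩, hP1.summable, h⟩
  ext e
  -- A single coefficient sees only the truncations at `u^N` and `t^M`, so both sides reduce to
  -- finite sums.
  set N := e GenVar.u with hN
  set M := e GenVar.t with hM
  have hu : ∀ {f g : MvPowerSeries GenVar K}, uVar K ^ (N + 1) ∣ f - g →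
      MvPowerSeries.coeff e f = MvPowerSeries.coeff e g := fun h =>
    coeff_eq_of_X_pow_dvd_sub (s := GenVar.u) h (Nat.lt_succ_self N)
  have ht : ∀ {f g : MvPowerSeries GenVar K}, tVar K ^ (M + 1) ∣ f - g →
      MvPowerSeries.coeff e f = MvPowerSeries.coeff e g := fun h =>
    coeff_eq_of_X_pow_dvd_sub (s := GenVar.t) h (Nat.lt_succ_self M)
  have haN : ∀ m : ℕ+, uVar K ^ (N + 1) ∣
      a m - ∑ n ∈ Finset.range (N + 1), uVar K ^ n * weightedCycleSum K m n := by
    intro m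
    have := dvd_add (ha2 m N) (prod_cycleFactor_congr K m N)
    rwa [sub_add_sub_cancel] at this
  -- The term `n = 0` is the source of `t/(1-t)`.
  have hsplit : ∀ m : ℕ+, ∑ n ∈ Finset.range (N + 1), uVar K ^ n * weightedCycleSum K m n =
      1 + ∑ n ∈ firstPNats N, uVar K ^ (n : ℕ) * weightedCycleSum K m n := by
    intro m
    rw [Finset.sum_range_succ', pow_zero, one_mul, weightedCycleSum_zero, add_comm, firstPNats,
      Finset.sum_map]
    rfl
  calc MvPowerSeries.coeff e (tVar K * (1 - tVar K)⁻¹ + P)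
      = MvPowerSeries.coeff e (∑ m ∈ firstPNats M, tVar K ^ (m : ℕ)) +
        MvPowerSeries.coeff e (∑ n ∈ firstPNats N, permTerm K (fun _ w => peakCount w) n) := by
        rw [map_add, ht (tVar_mul_inv_congr K M), hu (hP2 N)]
    _ = MvPowerSeries.coeff e (∑ m ∈ firstPNats M, tVar K ^ (m : ℕ)) +
        MvPowerSeries.coeff e (∑ n ∈ firstPNats N, ∑ m ∈ firstPNats M,
          tVar K ^ (m : ℕ) * (uVar K ^ (n : ℕ) * weightedCycleSum K m n)) := by
        rw [map_sum, map_sum _ _ (firstPNats N),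
          Finset.sum_congr rfl fun n _ => ht (permTerm_congr K n M)]
        simp only [map_sum]
    _ = MvPowerSeries.coeff e (∑ m ∈ firstPNats M, tVar K ^ (m : ℕ) *
          ∑ n ∈ Finset.range (N + 1), uVar K ^ n * weightedCycleSum K m n) := by
        rw [← map_add, Finset.sum_comm, ← Finset.sum_add_distrib]
        simp only [hsplit, mul_add, mul_one, Finset.mul_sum]
    _ = MvPowerSeries.coeff e (∑ m ∈ firstPNats M, tVar K ^ (m : ℕ) * a m) := by
        refine (hu ?_).symm
        rw [← Finset.sum_sub_distrib]
        refine Finset.dvd_sum fun m _ => ?_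
        rw [← mul_sub]
        exact Dvd.dvd.mul_left (haN m) _
    _ = MvPowerSeries.coeff e G := (ht (hG2 M)).symm
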